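/- Let $\Lambda$ be an Artin algebra and $\mathrm{mod}(\Lambda)$ the category of finitely generated left $\Lambda$-modules. For $M\in\mathrm{mod}(\Lambda)$ let $\mathrm{pd}\,M\in\mathbb N\cup\{\infty\}$ be the projective dimension (with $\mathrm{pd}\,0=0$) and let $\Omega M$ be the kernel of a projective cover of $M$. For a class $\mathcal X\subseteq\mathrm{mod}(\Lambda)$ put $\mathrm{fin.dim}(\mathcal X)=\sup\{\mathrm{pd}\,X : X\in\mathcal X,\ \mathrm{pd}\,X<\infty\}$ and $\mathrm{fin.dim}(\Lambda)=\mathrm{fin.dim}(\mathrm{mod}(\Lambda))$; let $\mathrm{add}\,\mathcal X$ be the class of direct summands of finite direct sums of modules in $\mathcal X$. Let $\mathcal P$ be the class of projective modules in $\mathrm{mod}(\Lambda)$. Let $K$ be the free abelian group on the isomorphism classes $[M]$, $M\in\mathrm{mod}(\Lambda)$, modulo $[M]-[X]-[Y]$ whenever $M\simeq X\oplus Y$, and let $L:K\to K$ be given by $L[M]=[\Omega M]$. For $\mathcal X=\mathrm{add}\,\mathcal X$ let $\langle\mathcal X\rangle\le K$ be generated by the classes of the indecomposable modules in $\mathcal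 X\cup\mathcal P$, and put $\langle X\rangle=\langle\mathrm{add}\,X\rangle$ for a module $X$. Let $\mathcal D\subseteq\mathrm{mod}(\Lambda)$ satisfy $\mathrm{add}\,\mathcal D=\mathcal D$ and $\Omega(\mathcal D)\subseteq\mathcal D$, let $\overline L$ be the endomorphism of $K_{\mathcal D}=K/\langle\mathcal D\rangle$ induced by $L$, and let $\overline{\langle X\rangle}=(\langle X\rangle+\langle\mathcal D\rangle)/\langle\mathcal D\rangle$. Let $\Phi_{[\mathcal D]}(X)$ be the least $k\in\mathbb N$ such that $\overline L:\overline L^m(\overline{\langle X\rangle})\to\overline L^{m+1}(\overline{\langle X\rangle})$ is an isomorphism for all $m\ge k$, and let $$\Psi_{[\mathcal D]}(X)=\Phi_{[\mathcal D]}(X)+\mathrm{fin.dim}\bigl(\{Z : Z \text{ is a direct summand of } \Omega^{\Phi_{[\mathcal D]}(X)}(X)\}\bigr).$$ Put $\Phi=\Phi_{[\mathcal P]}$ and $\Phi\,\mathrm{dim}(\mathcal X)=\sup\{\Phi(X):X\in\mathcal X\}$. For $n\in\mathbb N$ and $V\in\mathrm{mod}(\Lambda)$, $\Lambda$ is an $(n,V,\mathcal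 D)$-Lat-Igusa-Todorov algebra if, in addition, $\Phi\,\mathrm{dim}(\mathcal D)=0$ and every $M\in\mathrm{mod}(\Lambda)$ admits an exact sequence $0\to V_1\oplus D_1\to V_0\oplus D_0\to\Omega^nM\to0$ with $V_1,V_0\in\mathrm{add}\,V$ and $D_1,D_0\in\mathcal D$. It is an $n$-LIT-algebra if this holds for some $V$ and some such $\mathcal D$; it is an $n$-Igusa-Todorov algebra (Wei) if for some $V$ every $M$ admits an exact sequence $0\to V_1\to V_0\to\Omega^nM\to0$ with $V_1,V_0\in\mathrm{add}\,V$. Theorem. (1) If $\Lambda$ is an $(n,V,\mathcal D)$-Lat-Igusa-Todorov algebra, then $\mathrm{fin.dim}(\Lambda)\le\Psi_{[\mathcal D]}(V)+n+1<\infty$. (2) Hence $\mathrm{fin.dim}(\Lambda)<\infty$ for every $n$-LIT-algebra $\Lambda$. (3) Every $n$-Igusa-Todorov algebra is an $n$-LIT-algebra. (4) Every self-injective Artin algebra is a $0$-LIT-algebra. -/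

import Mathlib

universe u

namespace LatIgusaTodorov

/-- An Artin algebra: a ring `Λ` that is a finitely generated module over a commutative artinian
ring `R` acting through the centre of `Λ`. (Replacing `R` by its image in `Λ` shows that
restricting to base rings in the universe of `Λ` loses nothing.) -/
class IsArtinAlgebra (Λ : Type u) [Ring Λ] : Prop where
  exists_base : ∃ (R : Type u) (_ : CommRing R) (_ : Algebra R Λ),
    IsArtinianRing R ∧ Module.Finite R Λ

instance isArtinianRing_of_isArtinAlgebra (Λ : Type u) [Ring Λ] [IsArtinAlgebra Λ] :
    IsArtinianRing Λ := by
  obtain ⟨R, _, _, _, _⟩ := IsArtinAlgebra.exists_base (Λ := Λ)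
  exact IsArtinianRing.of_finite R Λ

section Basic

variable {Λ : Type u} [Ring Λ]

/-- `M ∣ N`: the module `M` is isomorphic to a direct summand of `N`. -/
def IsSummand (M N : FGModuleCat.{u} Λ) : Prop :=
  ∃ Z : FGModuleCat.{u} Λ, Nonempty (N ≃ₗ[Λ] (M × Z))

/-- `add 𝒳`: direct summands of finite direct sums of modules in `𝒳`. -/
def addClosure (X : Set (FGModuleCat.{u} Λ)) : Set (FGModuleCat.{u} Λ) :=
  {M | ∃ (k : ℕ) (F : Fin k → FGModuleCat.{u} Λ), (∀ i, F i ∈ X) ∧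
    IsSummand M (FGModuleCat.of Λ (∀ i, F i))}

/-- The class `𝒫` of finitely generated projective modules. -/
def projectives (Λ : Type u) [Ring Λ] : Set (FGModuleCat.{u} Λ) :=
  {M | Module.Projective Λ M}

/-- Indecomposable modules. -/
def IsIndecomposable (M : FGModuleCat.{u} Λ) : Prop :=
  Nontrivial M ∧ ∀ A B : Submodule Λ M, IsCompl A B → A = ⊥ ∨ B = ⊥

/-- The projective dimension in `ℕ ∪ {∞}`, with `pd 0 = 0`. -/
noncomputable def pd (M : FGModuleCat.{u} Λ) : ℕ∞ :=
  (CategoryTheory.projectiveDimension M.obj).unbotD 0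

/-- The finitistic dimension of a class of modules. -/
noncomputable def finDimClass (X : Set (FGModuleCat.{u} Λ)) : ℕ∞ :=
  ⨆ M ∈ X, ⨆ (_ : pd M < ⊤), pd M

/-- The finitistic dimension of the ring `Λ`. -/
noncomputable def finDim (Λ : Type u) [Ring Λ] : ℕ∞ :=
  finDimClass (Set.univ : Set (FGModuleCat.{u} Λ))

/-- A submodule `N` of `P` is superfluous if `U + N = P` implies `U = P`. -/
def IsSuperfluous {P : Type u} [AddCommGroup P] [Module Λ P] (N : Submodule Λ P) : Prop :=
  ∀ U : Submodule Λ P, U ⊔ N = ⊤ → U = ⊤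

/-- A projective cover: an epimorphism from a projective module with superfluous kernel. -/
structure IsProjectiveCover {P M : Type u} [AddCommGroup P] [Module Λ P] [AddCommGroup M]
    [Module Λ M] (f : P →ₗ[Λ] M) : Prop where
  projective : Module.Projective Λ P
  surjective : Function.Surjective f
  superfluous : IsSuperfluous (LinearMap.ker f)

theorem IsSuperfluous.map {P Q : Type u} [AddCommGroup P] [Module Λ P] [AddCommGroup Q]
    [Module Λ Q] {N : Submodule Λ P} (hN : IsSuperfluous N) (h : P →ₗ[Λ] Q) :
    IsSuperfluous (N.map h) := by
  intro U hU
  have h1 : U.comap h ⊔ N = ⊤ := by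
    rw [eq_top_iff]
    intro p _
    have : h p ∈ U ⊔ N.map h := hU ▸ Submodule.mem_top
    obtain ⟨y, hy, z, hz, hyz⟩ := Submodule.mem_sup.1 this
    obtain ⟨n, hn, rfl⟩ := Submodule.mem_map.1 hz
    refine Submodule.mem_sup.2 ⟨p - n, ?_, n, hn, by abel⟩
    rw [Submodule.mem_comap, map_sub, ← hyz]
    simpa using hy
  have h2 := hN _ h1
  have h3 : N.map h ≤ U := by
    rw [Submodule.map_le_iff_le_comap, h2]
    exact le_top
  rwa [sup_eq_left.2 h3] at hU

theorem IsSuperfluous.sup {P : Type u} [AddCommGroup P] [Module Λ P] {N N' : Submodule Λ P}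
    (hN : IsSuperfluous N) (hN' : IsSuperfluous N') : IsSuperfluous (N ⊔ N') := by
  intro U hU
  rw [← sup_assoc] at hU
  exact hN _ (hN' _ hU)

theorem IsSuperfluous.prod {P Q : Type u} [AddCommGroup P] [Module Λ P] [AddCommGroup Q]
    [Module Λ Q] {N : Submodule Λ P} {N' : Submodule Λ Q} (hN : IsSuperfluous N)
    (hN' : IsSuperfluous N') : IsSuperfluous (N.prod N') := by
  have := (hN.map (LinearMap.inl Λ P Q)).sup (hN'.map (LinearMap.inr Λ P Q))
  rwa [← LinearMap.prod_eq_sup_map] at this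

theorem IsProjectiveCover.prodMap {P Q M N : Type u} [AddCommGroup P] [Module Λ P]
    [AddCommGroup Q] [Module Λ Q] [AddCommGroup M] [Module Λ M] [AddCommGroup N] [Module Λ N]
    {f : P →ₗ[Λ] M} {g : Q →ₗ[Λ] N} (hf : IsProjectiveCover f) (hg : IsProjectiveCover g) :
    IsProjectiveCover (f.prodMap g) where
  projective := by
    have := hf.projective
    have := hg.projective
    infer_instance
  surjective := Function.Surjective.prodMap hf.surjective hg.surjective
  superfluous := by
    rw [LinearMap.ker_prodMap]
    exact hf.superfluous.prod hg.superfluous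

/-- Projective covers are unique up to isomorphism, hence so are their kernels. -/
theorem IsProjectiveCover.nonempty_ker_equiv {P Q M N : Type u} [AddCommGroup P] [Module Λ P]
    [AddCommGroup Q] [Module Λ Q] [AddCommGroup M] [Module Λ M] [AddCommGroup N] [Module Λ N]
    {f : P →ₗ[Λ] M} {g : Q →ₗ[Λ] N} (hf : IsProjectiveCover f) (hg : IsProjectiveCover g)
    (e : M ≃ₗ[Λ] N) : Nonempty (LinearMap.ker f ≃ₗ[Λ] LinearMap.ker g) := by
  have := hf.projective
  have := hg.projective
  obtain ⟨h, hh⟩ := Module.projective_lifting_property g (e.toLinearMap ∘ₗ f) hg.surjective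
  have hgh : ∀ p, g (h p) = e (f p) := fun p => LinearMap.congr_fun hh p
  have hker : LinearMap.ker h ≤ LinearMap.ker f := by
    intro p hp
    have h0 := hgh p
    rw [LinearMap.mem_ker.1 hp, map_zero] at h0
    exact (LinearMap.mem_ker).2 (e.map_eq_zero_iff.1 h0.symm)
  have hsurj : Function.Surjective h := by
    rw [← LinearMap.range_eq_top]
    apply hg.superfluous
    rw [eq_top_iff]
    intro q _
    obtain ⟨p, hp⟩ := hf.surjective (e.symm (g q))
    refine Submodule.mem_sup.2 ⟨h p, ⟨p, rfl⟩, q - h p, ?_, by abel⟩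
    rw [LinearMap.mem_ker, map_sub, hgh, hp]
    simp
  have hinj : Function.Injective h := by
    obtain ⟨s, hs⟩ := Module.projective_lifting_property h LinearMap.id hsurj
    have hs' : ∀ q, h (s q) = q := fun q => LinearMap.congr_fun hs q
    have hr : LinearMap.range s = ⊤ := by
      apply hf.superfluous
      rw [eq_top_iff]
      intro p _
      refine Submodule.mem_sup.2 ⟨s (h p), ⟨h p, rfl⟩, p - s (h p), hker ?_, by abel⟩
      rw [LinearMap.mem_ker, map_sub, hs', sub_self]
    intro p p' hpp
    obtain ⟨q, rfl⟩ := LinearMap.range_eq_top.1 hr p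
    obtain ⟨q', rfl⟩ := LinearMap.range_eq_top.1 hr p'
    rw [hs', hs'] at hpp
    rw [hpp]
  let E := LinearEquiv.ofBijective h ⟨hinj, hsurj⟩
  refine ⟨E.submoduleMap (LinearMap.ker f) ≪≫ₗ LinearEquiv.ofEq _ _ ?_⟩
  ext q
  constructor
  · rintro ⟨p, hp, rfl⟩
    have hp' : f p = 0 := hp
    change g (h p) = 0
    rw [hgh, hp', map_zero]
  · intro hq
    obtain ⟨p, rfl⟩ := hsurj q
    refine ⟨p, ?_, rfl⟩
    have h0 : g (h p) = 0 := hq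
    rw [hgh] at h0
    exact e.map_eq_zero_iff.1 h0

end Basic

section Syzygy

variable {Λ : Type u} [Ring Λ] [IsArtinAlgebra Λ]

/-- Finitely generated modules over an Artin algebra have finitely generated projective covers. -/
theorem exists_projectiveCover (M : FGModuleCat.{u} Λ) :
    ∃ (P : FGModuleCat.{u} Λ) (f : P →ₗ[Λ] M), IsProjectiveCover f := by
  obtain ⟨n, f₀, hf₀⟩ := Module.Finite.exists_fin' Λ M
  let S : Set (Submodule Λ (Fin n → Λ)) :=
    {A | Module.Projective Λ A ∧ ∃ f : A →ₗ[Λ] M, Function.Surjective f}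
  have hS : S.Nonempty := by
    refine ⟨⊤, Module.Projective.of_equiv (Submodule.topEquiv (R := Λ) (M := Fin n → Λ)).symm,
      f₀ ∘ₗ (Submodule.topEquiv (R := Λ) (M := Fin n → Λ)).toLinearMap, ?_⟩
    exact hf₀.comp (LinearEquiv.surjective _)
  obtain ⟨A, ⟨hA, f, hf⟩, hmin⟩ :=
    WellFounded.has_min (wellFounded_lt (α := Submodule Λ (Fin n → Λ))) S hS
  refine ⟨FGModuleCat.of Λ A, f, hA, hf, ?_⟩
  intro U hU
  have hfU : Function.Surjective (f ∘ₗ U.subtype) := by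
    intro m
    obtain ⟨a, rfl⟩ := hf m
    have : a ∈ U ⊔ LinearMap.ker f := hU ▸ Submodule.mem_top
    obtain ⟨y, hy, z, hz, rfl⟩ := Submodule.mem_sup.1 this
    refine ⟨⟨y, hy⟩, ?_⟩
    have hz' : f z = 0 := hz
    simp [hz']
  obtain ⟨g, hg⟩ := Module.projective_lifting_property (f ∘ₗ U.subtype) f hfU
  let φ : Module.End Λ A := U.subtype ∘ₗ g
  have hφ : ∀ a, f (φ a) = f a := fun a => LinearMap.congr_fun hg a
  have hφn : ∀ (k : ℕ) a, f ((φ ^ k) a) = f a := by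
    intro k
    induction k with
    | zero => intro a; simp
    | succ k ih => intro a; rw [pow_succ, Module.End.mul_apply, ih, hφ]
  obtain ⟨k, hk⟩ := Filter.eventually_atTop.1 φ.eventually_isCompl_ker_pow_range_pow
  have hc := hk (k + 1) (Nat.le_succ k)
  set B : Submodule Λ A := LinearMap.range (φ ^ (k + 1)) with hB
  have hBproj : Module.Projective Λ B :=
    Module.Projective.of_split B.subtype (B.projectionOnto _ hc.symm)
      (by ext x; simp)
  have hBU : B ≤ U := by
    rintro _ ⟨a, rfl⟩
    rw [pow_succ', Module.End.mul_apply]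
    exact (g _).2
  let e := Submodule.equivSubtypeMap A B
  have hmem : B.map A.subtype ∈ S := by
    refine ⟨Module.Projective.of_equiv e, (f ∘ₗ B.subtype) ∘ₗ e.symm.toLinearMap, ?_⟩
    refine Function.Surjective.comp (g := f ∘ₗ B.subtype) ?_ e.symm.surjective
    intro m
    obtain ⟨a, rfl⟩ := hf m
    exact ⟨⟨_, a, rfl⟩, hφn (k + 1) a⟩
  have hBtop : B = ⊤ := by
    by_contra hne
    apply hmin _ hmem
    refine lt_of_le_of_ne (Submodule.map_subtype_le A B) fun h => hne ?_
    rw [eq_top_iff]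
    intro a _
    have : (a : Fin n → Λ) ∈ B.map A.subtype := h.symm.le a.2
    obtain ⟨b, hb, hba⟩ := this
    rwa [← Subtype.ext hba]
  exact eq_top_iff.2 (hBtop ▸ hBU)

/-- The syzygy `Ω M`: the kernel of a projective cover of `M`. -/
noncomputable def syzygy (M : FGModuleCat.{u} Λ) : FGModuleCat.{u} Λ :=
  FGModuleCat.of Λ (LinearMap.ker (exists_projectiveCover M).choose_spec.choose)

theorem syzygy_equiv_ker {P M : FGModuleCat.{u} Λ} {f : P →ₗ[Λ] M} (hf : IsProjectiveCover f) :
    Nonempty (syzygy M ≃ₗ[Λ] LinearMap.ker f) :=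
  (exists_projectiveCover M).choose_spec.choose_spec.nonempty_ker_equiv hf (LinearEquiv.refl Λ M)

theorem syzygy_equiv {M N : FGModuleCat.{u} Λ} (e : M ≃ₗ[Λ] N) :
    Nonempty (syzygy M ≃ₗ[Λ] syzygy N) :=
  (exists_projectiveCover M).choose_spec.choose_spec.nonempty_ker_equiv
    (exists_projectiveCover N).choose_spec.choose_spec e

theorem syzygy_prod {M X Y : FGModuleCat.{u} Λ} (e : M ≃ₗ[Λ] (X × Y)) :
    Nonempty (syzygy M ≃ₗ[Λ] (syzygy X × syzygy Y)) := by
  have hX := (exists_projectiveCover X).choose_spec.choose_spec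
  have hY := (exists_projectiveCover Y).choose_spec.choose_spec
  obtain ⟨E⟩ := (exists_projectiveCover M).choose_spec.choose_spec.nonempty_ker_equiv
    (hX.prodMap hY) e
  refine ⟨E ≪≫ₗ LinearEquiv.ofEq _ _ (LinearMap.ker_prodMap _ _) ≪≫ₗ
    { toFun := fun x => (⟨x.1.1, x.2.1⟩, ⟨x.1.2, x.2.2⟩)
      invFun := fun y => ⟨(y.1.1, y.2.1), ⟨y.1.2, y.2.2⟩⟩
      map_add' := fun _ _ => rfl
      map_smul' := fun _ _ => rfl
      left_inv := fun _ => rfl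
      right_inv := fun _ => rfl }⟩

theorem subsingleton_syzygy {M : FGModuleCat.{u} Λ} (hM : Module.Projective Λ M) :
    Subsingleton (syzygy M) := by
  have hid : IsProjectiveCover (LinearMap.id : M →ₗ[Λ] M) :=
    ⟨hM, Function.surjective_id, by
      intro U hU
      rwa [LinearMap.ker_id, sup_bot_eq] at hU⟩
  obtain ⟨e⟩ := syzygy_equiv_ker hid
  have : Subsingleton (LinearMap.ker (LinearMap.id : M →ₗ[Λ] M)) := by
    rw [LinearMap.ker_id]
    infer_instance
  exact e.toEquiv.subsingleton

end Syzygy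

section SplitGroup

/-- Isomorphism of finitely generated modules. -/
abbrev isoSetoid (Λ : Type u) [Ring Λ] : Setoid (FGModuleCat.{u} Λ) where
  r M N := Nonempty (M ≃ₗ[Λ] N)
  iseqv := ⟨fun M => ⟨LinearEquiv.refl Λ M⟩, fun ⟨e⟩ => ⟨e.symm⟩, fun ⟨e⟩ ⟨e'⟩ => ⟨e.trans e'⟩⟩

/-- Isomorphism classes of finitely generated modules. -/
abbrev IsoClass (Λ : Type u) [Ring Λ] : Type (u + 1) := Quotient (isoSetoid Λ)

/-- The relations `[M] - [X] - [Y]` for `M ≃ X ⊕ Y`. -/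
def splitRelations (Λ : Type u) [Ring Λ] : AddSubgroup (FreeAbelianGroup (IsoClass Λ)) :=
  AddSubgroup.closure {r | ∃ M X Y : FGModuleCat.{u} Λ, Nonempty (M ≃ₗ[Λ] (X × Y)) ∧
    r = FreeAbelianGroup.of (Quotient.mk (isoSetoid Λ) M)
      - FreeAbelianGroup.of (Quotient.mk (isoSetoid Λ) X)
      - FreeAbelianGroup.of (Quotient.mk (isoSetoid Λ) Y)}

/-- The group `K`: the free abelian group on isomorphism classes of finitely generated modules,
modulo `[M] - [X] - [Y]` whenever `M ≃ X ⊕ Y`. -/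
abbrev K (Λ : Type u) [Ring Λ] : Type (u + 1) :=
  FreeAbelianGroup (IsoClass Λ) ⧸ splitRelations Λ

variable {Λ : Type u} [Ring Λ]

/-- The class `[M]` in `K`. -/
def cls (M : FGModuleCat.{u} Λ) : K Λ :=
  QuotientAddGroup.mk (FreeAbelianGroup.of (Quotient.mk (isoSetoid Λ) M))

theorem cls_congr {M N : FGModuleCat.{u} Λ} (e : M ≃ₗ[Λ] N) : cls M = cls N := by
  have : Quotient.mk (isoSetoid Λ) M = Quotient.mk (isoSetoid Λ) N := Quotient.sound ⟨e⟩
  rw [cls, cls, this]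

theorem cls_prod {M X Y : FGModuleCat.{u} Λ} (e : M ≃ₗ[Λ] (X × Y)) :
    cls M = cls X + cls Y := by
  rw [← sub_eq_zero, ← sub_sub]
  exact (QuotientAddGroup.eq_zero_iff _).2 (AddSubgroup.subset_closure ⟨M, X, Y, ⟨e⟩, rfl⟩)

theorem cls_eq_zero (M : FGModuleCat.{u} Λ) [Subsingleton M] : cls M = 0 := by
  have h : cls M = cls M + cls M :=
    cls_prod (LinearEquiv.ofSubsingleton M (M × M))
  simpa using h

/-- `⟨𝒳⟩`: the subgroup of `K` generated by the classes of the indecomposable objects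
of `𝒳 ∪ 𝒫`. -/
def bracket (X : Set (FGModuleCat.{u} Λ)) : AddSubgroup (K Λ) :=
  AddSubgroup.closure {x | ∃ M ∈ X ∪ projectives Λ, IsIndecomposable M ∧ x = cls M}

theorem subset_addClosure (X : Set (FGModuleCat.{u} Λ)) : X ⊆ addClosure X := by
  intro M hM
  exact ⟨1, fun _ => M, fun _ => hM, FGModuleCat.of Λ PUnit.{u + 1},
    ⟨LinearEquiv.funUnique (Fin 1) Λ M ≪≫ₗ (LinearEquiv.prodUnique (R := Λ) (M₂ := PUnit.{u + 1})).symm⟩⟩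

theorem mem_of_isSummand {X : Set (FGModuleCat.{u} Λ)} (hX : addClosure X = X)
    {M N : FGModuleCat.{u} Λ} (hN : N ∈ X) (h : IsSummand M N) : M ∈ X := by
  obtain ⟨Z, ⟨e⟩⟩ := h
  rw [← hX]
  exact ⟨1, fun _ => N, fun _ => hN, Z, ⟨LinearEquiv.funUnique (Fin 1) Λ N ≪≫ₗ e⟩⟩

theorem addClosure_projectives (Λ : Type u) [Ring Λ] :
    addClosure (projectives Λ) = projectives Λ := by
  refine Set.Subset.antisymm ?_ (subset_addClosure _)
  rintro M ⟨k, F, hF, Z, ⟨e⟩⟩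
  have : ∀ i, Module.Projective Λ (F i) := hF
  have : Module.Projective Λ (FGModuleCat.of Λ (∀ i, F i)) :=
    Module.Projective.of_equiv (DFinsupp.linearEquivFunOnFintype (R := Λ) (M := fun i => F i))
  exact Module.Projective.of_split (e.symm.toLinearMap ∘ₗ LinearMap.inl Λ M Z)
    (LinearMap.fst Λ M Z ∘ₗ e.toLinearMap) (by ext x; simp)

/-- If `𝒳 = add 𝒳` then `[M] ∈ ⟨𝒳⟩` for all `M ∈ 𝒳`, since `M` is a finite direct sum of
indecomposable modules. -/
theorem cls_mem_bracket [IsArtinAlgebra Λ] {X : Set (FGModuleCat.{u} Λ)} (hX : addClosure X = X)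
    {M : FGModuleCat.{u} Λ} (hM : M ∈ X) : cls M ∈ bracket X := by
  suffices h : ∀ A : Submodule Λ M, FGModuleCat.of Λ A ∈ X →
      cls (FGModuleCat.of Λ A) ∈ bracket X by
    have e : M ≃ₗ[Λ] (⊤ : Submodule Λ M) := Submodule.topEquiv.symm
    have hT : FGModuleCat.of Λ (⊤ : Submodule Λ M) ∈ X :=
      mem_of_isSummand hX hM ⟨FGModuleCat.of Λ PUnit.{u + 1},
        ⟨e ≪≫ₗ (LinearEquiv.prodUnique (R := Λ) (M₂ := PUnit.{u + 1})).symm⟩⟩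
    have := h ⊤ hT
    rwa [← cls_congr (N := FGModuleCat.of Λ (⊤ : Submodule Λ M)) e] at this
  intro A
  induction A using WellFoundedLT.induction with
  | ind A ih =>
    intro hA
    by_cases h0 : Subsingleton A
    · have : Subsingleton (FGModuleCat.of Λ A) := h0
      rw [cls_eq_zero]
      exact zero_mem _
    by_cases hi : IsIndecomposable (FGModuleCat.of Λ A)
    · exact AddSubgroup.subset_closure ⟨_, Or.inl hA, hi, rfl⟩
    have hnt : Nontrivial A := not_subsingleton_iff_nontrivial.1 h0
    have : ∃ B C : Submodule Λ A, IsCompl B C ∧ B ≠ ⊥ ∧ C ≠ ⊥ := by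
      by_contra hcon
      push Not at hcon
      exact hi ⟨hnt, fun B C hBC => or_iff_not_imp_left.2 (hcon B C hBC)⟩
    obtain ⟨B, C, hBC, hB, hC⟩ := this
    have key : ∀ B C : Submodule Λ A, IsCompl B C → C ≠ ⊥ →
        FGModuleCat.of Λ B ∈ X ∧ cls (FGModuleCat.of Λ B) ∈ bracket X := by
      intro B C hBC hC
      let e : B ≃ₗ[Λ] B.map A.subtype := Submodule.equivSubtypeMap A B
      have hBX : FGModuleCat.of Λ B ∈ X :=
        mem_of_isSummand hX hA ⟨FGModuleCat.of Λ C, ⟨(Submodule.prodEquivOfIsCompl B C hBC).symm⟩⟩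
      have hB' : FGModuleCat.of Λ (B.map A.subtype) ∈ X :=
        mem_of_isSummand hX hBX ⟨FGModuleCat.of Λ PUnit.{u + 1},
          ⟨e ≪≫ₗ (LinearEquiv.prodUnique (R := Λ) (M₂ := PUnit.{u + 1})).symm⟩⟩
      have hlt : B.map A.subtype < A := by
        refine lt_of_le_of_ne (Submodule.map_subtype_le A B) fun h => hC ?_
        have hBt : B = ⊤ := by
          rw [eq_top_iff]
          intro a _
          have : (a : M) ∈ B.map A.subtype := h.symm.le a.2
          obtain ⟨b, hb, hba⟩ := this
          rwa [← Subtype.ext hba]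
        have := hBC.disjoint
        rw [hBt, disjoint_comm, disjoint_top] at this
        exact this
      refine ⟨hBX, ?_⟩
      rw [cls_congr (M := FGModuleCat.of Λ B) (N := FGModuleCat.of Λ (B.map A.subtype)) e]
      exact ih _ hlt hB'
    rw [cls_prod (M := FGModuleCat.of Λ A) (X := FGModuleCat.of Λ B) (Y := FGModuleCat.of Λ C)
      (Submodule.prodEquivOfIsCompl B C hBC).symm]
    exact add_mem (key B C hBC hC).2 (key C B hBC.symm hB).2

end SplitGroup

section IgusaTodorov

/-- For an endomorphism `f` of an abelian group and a subgroup `X`, the least `k` such that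
`f : f^m(X) → f^(m+1)(X)` is an isomorphism for all `m ≥ k`. -/
noncomputable def eta {G : Type*} [AddCommGroup G] (f : G →+ G) (X : AddSubgroup G) : ℕ :=
  sInf {k : ℕ | ∀ m ≥ k, Set.BijOn f (f^[m] '' (X : Set G)) (f^[m + 1] '' (X : Set G))}

/-- Classes `𝒟` of finitely generated modules with `add 𝒟 = 𝒟` and `Ω(𝒟) ⊆ 𝒟`. -/
structure SyzygyClosedClass (Λ : Type u) [Ring Λ] [IsArtinAlgebra Λ] where
  carrier : Set (FGModuleCat.{u} Λ)
  add_eq : addClosure carrier = carrier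
  syzygy_mem : ∀ M ∈ carrier, syzygy M ∈ carrier

/-- The class `𝒫` of projective modules satisfies `add 𝒫 = 𝒫` and `Ω(𝒫) ⊆ 𝒫`. -/
def projClass (Λ : Type u) [Ring Λ] [IsArtinAlgebra Λ] : SyzygyClosedClass Λ where
  carrier := projectives Λ
  add_eq := addClosure_projectives Λ
  syzygy_mem := fun _ hM => by
    have := subsingleton_syzygy hM
    exact Module.Projective.of_free

variable {Λ : Type u} [Ring Λ] [IsArtinAlgebra Λ]

/-- The endomorphism `L` of `K` with `L [M] = [Ω M]`. -/
noncomputable def L (Λ : Type u) [Ring Λ] [IsArtinAlgebra Λ] : K Λ →+ K Λ :=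
  QuotientAddGroup.lift (splitRelations Λ)
    (FreeAbelianGroup.lift (Quotient.lift (fun M : FGModuleCat.{u} Λ => cls (syzygy M))
      (fun _ _ ⟨e⟩ => (syzygy_equiv e).elim cls_congr)))
    (by
      refine (AddSubgroup.closure_le _).2 ?_
      rintro _ ⟨M, X, Y, ⟨e⟩, rfl⟩
      obtain ⟨e'⟩ := syzygy_prod e
      simp only [SetLike.mem_coe, AddMonoidHom.mem_ker, map_sub, FreeAbelianGroup.lift_apply_of]
      change cls (syzygy M) - cls (syzygy X) - cls (syzygy Y) = 0
      rw [cls_prod e']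
      abel)

theorem L_cls (M : FGModuleCat.{u} Λ) : L Λ (cls M) = cls (syzygy M) :=
  FreeAbelianGroup.lift_apply_of _ _

namespace SyzygyClosedClass

variable (D : SyzygyClosedClass Λ)

theorem bracket_le_comap : bracket D.carrier ≤ (bracket D.carrier).comap (L Λ) := by
  rw [bracket, AddSubgroup.closure_le]
  rintro _ ⟨M, hM, -, rfl⟩
  change L Λ (cls M) ∈ bracket D.carrier
  rw [L_cls]
  rcases hM with hM | hM
  · exact cls_mem_bracket D.add_eq (D.syzygy_mem M hM)
  · have := subsingleton_syzygy hM
    rw [cls_eq_zero]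
    exact zero_mem _

/-- The quotient `K_𝒟 = K / ⟨𝒟⟩`. -/
abbrev KD : Type (u + 1) := K Λ ⧸ bracket D.carrier

/-- The endomorphism of `K_𝒟` induced by `L`. -/
noncomputable def Lbar : D.KD →+ D.KD :=
  QuotientAddGroup.map (bracket D.carrier) (bracket D.carrier) (L Λ) D.bracket_le_comap

/-- The image in `K_𝒟` of `⟨X⟩ = ⟨add X⟩`, that is, `(⟨X⟩ + ⟨𝒟⟩) / ⟨𝒟⟩`. -/
def bracketBar (X : FGModuleCat.{u} Λ) : AddSubgroup D.KD :=
  (bracket (addClosure {X})).map (QuotientAddGroup.mk' (bracket D.carrier))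

/-- The function `Φ_[𝒟]`. -/
noncomputable def Phi (X : FGModuleCat.{u} Λ) : ℕ :=
  eta D.Lbar (D.bracketBar X)

/-- The function `Ψ_[𝒟]`, valued in `ℕ ∪ {∞}` since the finitistic dimension is a supremum. -/
noncomputable def Psi (X : FGModuleCat.{u} Λ) : ℕ∞ :=
  (D.Phi X : ℕ∞) + finDimClass {Z | IsSummand Z (syzygy^[D.Phi X] X)}

end SyzygyClosedClass

/-- The `Φ`-dimension of a class, for the classical Igusa-Todorov function `Φ = Φ_[𝒫]`. -/
noncomputable def PhiDim (X : Set (FGModuleCat.{u} Λ)) : ℕ∞ :=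
  ⨆ M ∈ X, ((projClass Λ).Phi M : ℕ∞)

/-- `Λ` is an `(n, V, 𝒟)`-Lat-Igusa-Todorov algebra: `Φdim 𝒟 = 0` and every `M` admits an exact
sequence `0 → V₁ ⊕ D₁ → V₀ ⊕ D₀ → Ωⁿ M → 0` with `V₁, V₀ ∈ add V` and `D₁, D₀ ∈ 𝒟`. -/
structure IsLITWith (n : ℕ) (V : FGModuleCat.{u} Λ) (D : SyzygyClosedClass Λ) : Prop where
  phiDim_eq_zero : PhiDim D.carrier = 0
  exact_seq : ∀ M : FGModuleCat.{u} Λ,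
    ∃ V₁ ∈ addClosure {V}, ∃ V₀ ∈ addClosure {V}, ∃ D₁ ∈ D.carrier, ∃ D₀ ∈ D.carrier,
    ∃ (f : (V₁ × D₁) →ₗ[Λ] (V₀ × D₀)) (g : (V₀ × D₀) →ₗ[Λ] syzygy^[n] M),
      Function.Injective f ∧ Function.Exact f g ∧ Function.Surjective g

/-- `Λ` is an `n`-Lat-Igusa-Todorov algebra. -/
def IsLIT (Λ : Type u) [Ring Λ] [IsArtinAlgebra Λ] (n : ℕ) : Prop :=
  ∃ (V : FGModuleCat.{u} Λ) (D : SyzygyClosedClass Λ), IsLITWith n V D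

/-- `Λ` is an `n`-Igusa-Todorov algebra in the sense of Wei: there is `V` such that every `M`
admits an exact sequence `0 → V₁ → V₀ → Ωⁿ M → 0` with `V₁, V₀ ∈ add V`. -/
def IsIT (Λ : Type u) [Ring Λ] [IsArtinAlgebra Λ] (n : ℕ) : Prop :=
  ∃ V : FGModuleCat.{u} Λ, ∀ M : FGModuleCat.{u} Λ,
    ∃ V₁ ∈ addClosure {V}, ∃ V₀ ∈ addClosure {V},
    ∃ (f : V₁ →ₗ[Λ] V₀) (g : V₀ →ₗ[Λ] syzygy^[n] M),
      Function.Injective f ∧ Function.Exact f g ∧ Function.Surjective g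

end IgusaTodorov

end LatIgusaTodorov

/-! Part (1) compares the two ends of a resolution `0 → V₁ ⊕ D₁ → V₀ ⊕ D₀ → N → 0` with `pd N = p`
finite. Syzygies beyond `p` kill `N`, so there the two left-hand terms agree up to projectives.
Modulo `⟨𝒟⟩` only the `V`-parts remain, and `Φ_[𝒟]` says that they agree already after `φ =
Φ_[𝒟](V)` steps: `Ω^φ V₁` and `Ω^φ V₀` share a summand `W`, with complements built from `𝒟` and
projectives. The hypothesis `Φdim 𝒟 = 0` then matches these leftovers, together with the `𝒟`-parts,
up to projectives. This gives `0 → Z ⊕ P₁ → Z ⊕ P₀ → Ω^φ N → 0` with `P₁`, `P₀` projective and `Z =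
W ⊕ T`, where `T` is built from `𝒟` and `𝒫`.

Fitting's lemma cancels the part of `Z` on which the block `Z → Z` is invertible
(`exists_summand_isNilpotent`). On the remaining `Z₁` the block is nilpotent; in high degrees it
also acts surjectively on `Ext`, so `Z₁` has finite projective dimension (`pd_le_of_isNilpotent`).
An indecomposable summand of `Z₁` is either a summand of `Ω^φ V`, hence bounded by the finitistic
term of `Ψ`, or it comes from `𝒟 ∪ 𝒫` and is projective, because `Φdim 𝒟 = 0` forbids nonprojective
indecomposables of finite projective dimension in `𝒟`. So `pd N ≤ Ψ + 1` (`pd_le_Psi_add_one`), and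
shifting by `n` finishes. Finiteness of `Ψ` holds because a module has finitely many indecomposable
summands up to isomorphism.

Reading isomorphisms off equalities in `K` requires Krull-Schmidt, used here in the form of
multiplicity homomorphisms `multHom : K → ℤ`. Part (2) is immediate from (1), part (3) takes `𝒟 =
𝒫`, and part (4) takes `𝒟` to be all modules: over a self-injective algebra the dual Schanuel lemma
makes `L` injective modulo projectives. -/

namespace LatIgusaTodorov

/-! ### Krull-Schmidt theory through multiplicities of indecomposables. -/

section Decomposition

variable {Λ : Type u} [Ring Λ]

theorem IsSummand.refl (M : FGModuleCat.{u} Λ) : IsSummand M M :=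
  ⟨FGModuleCat.of Λ PUnit.{u + 1},
    ⟨(LinearEquiv.prodUnique (R := Λ) (M := M) (M₂ := PUnit.{u + 1})).symm⟩⟩

theorem IsSummand.of_equiv {M M' N N' : FGModuleCat.{u} Λ} (h : IsSummand M N)
    (e : M ≃ₗ[Λ] M') (e' : N ≃ₗ[Λ] N') : IsSummand M' N' := by
  obtain ⟨Z, ⟨f⟩⟩ := h
  exact ⟨Z, ⟨e'.symm ≪≫ₗ f ≪≫ₗ e.prodCongr (LinearEquiv.refl Λ Z)⟩⟩

theorem IsSummand.trans {A B C : FGModuleCat.{u} Λ} (h : IsSummand A B) (h' : IsSummand B C) :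
    IsSummand A C := by
  obtain ⟨Y, ⟨f⟩⟩ := h
  obtain ⟨Z, ⟨g⟩⟩ := h'
  exact ⟨FGModuleCat.of Λ (Y × Z),
    ⟨g ≪≫ₗ f.prodCongr (LinearEquiv.refl Λ Z) ≪≫ₗ LinearEquiv.prodAssoc Λ A Y Z⟩⟩

theorem isSummand_left {M X Y : FGModuleCat.{u} Λ} (e : M ≃ₗ[Λ] (X × Y)) : IsSummand X M :=
  ⟨Y, ⟨e⟩⟩

theorem isSummand_right {M X Y : FGModuleCat.{u} Λ} (e : M ≃ₗ[Λ] (X × Y)) : IsSummand Y M :=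
  ⟨X, ⟨e ≪≫ₗ LinearEquiv.prodComm Λ X Y⟩⟩

theorem isSummand_of_leftInverse {M N : FGModuleCat.{u} Λ} (g : M →ₗ[Λ] N) (f : N →ₗ[Λ] M)
    (h : ∀ x, f (g x) = x) : IsSummand M N := by
  have hN : Module.Finite Λ (N ⧸ LinearMap.range g) := inferInstance
  let φ : N →ₗ[Λ] (M × (N ⧸ LinearMap.range g)) := f.prod (LinearMap.range g).mkQ
  have hinj : Function.Injective φ := by
    rw [← LinearMap.ker_eq_bot, LinearMap.ker_eq_bot']
    intro x hx
    obtain ⟨y, rfl⟩ := (Submodule.Quotient.mk_eq_zero _).1 (congrArg Prod.snd hx)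
    have : f (g y) = 0 := congrArg Prod.fst hx
    rw [h] at this
    rw [this, map_zero]
  have hsurj : Function.Surjective φ := by
    rintro ⟨m, z⟩
    obtain ⟨n, rfl⟩ := Submodule.mkQ_surjective _ z
    refine ⟨g (m - f n) + n, Prod.ext ?_ ?_⟩
    · change f (g (m - f n) + n) = m
      rw [map_add, h]; abel
    · change (LinearMap.range g).mkQ (g (m - f n) + n) = (LinearMap.range g).mkQ n
      rw [map_add, add_eq_right]
      exact (Submodule.Quotient.mk_eq_zero _).2 ⟨_, rfl⟩
  exact ⟨FGModuleCat.of Λ (N ⧸ LinearMap.range g), ⟨LinearEquiv.ofBijective φ ⟨hinj, hsurj⟩⟩⟩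

theorem IsIndecomposable.of_equiv {M N : FGModuleCat.{u} Λ} (h : IsIndecomposable M)
    (e : M ≃ₗ[Λ] N) : IsIndecomposable N := by
  have := h.1
  refine ⟨e.symm.toEquiv.nontrivial, fun A B hAB => ?_⟩
  have hc : IsCompl (A.comap e.toLinearMap) (B.comap e.toLinearMap) :=
    hAB.map (Submodule.orderIsoMapComap e).symm
  have key : ∀ C : Submodule Λ N, C.comap e.toLinearMap = ⊥ → C = ⊥ := by
    intro C hC
    exact (map_eq_bot_iff (Submodule.orderIsoMapComap e).symm).1 hC
  exact (h.2 _ _ hc).imp (key A) (key B)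

theorem IsIndecomposable.subsingleton_of_equiv_prod {M X Y : FGModuleCat.{u} Λ}
    (h : IsIndecomposable M) (e : M ≃ₗ[Λ] (X × Y)) : Subsingleton X ∨ Subsingleton Y := by
  have hc : IsCompl ((Submodule.prod ⊤ ⊥ : Submodule Λ (X × Y)).comap e.toLinearMap)
      ((Submodule.prod ⊥ ⊤ : Submodule Λ (X × Y)).comap e.toLinearMap) := by
    refine IsCompl.map (Submodule.orderIsoMapComap e).symm
      (show IsCompl (Submodule.prod (⊤ : Submodule Λ X) (⊥ : Submodule Λ Y))
        (Submodule.prod (⊥ : Submodule Λ X) (⊤ : Submodule Λ Y)) from ⟨?_, ?_⟩)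
    · rw [disjoint_iff, Submodule.prod_inf_prod]
      simp
    · rw [codisjoint_iff, Submodule.prod_sup_prod]
      simp
  rcases h.2 _ _ hc with h0 | h0
  · left
    refine subsingleton_of_forall_eq 0 fun x => ?_
    have : e.symm (x, 0) ∈ (Submodule.prod ⊤ ⊥ : Submodule Λ (X × Y)).comap e.toLinearMap := by
      simp
    rw [h0, Submodule.mem_bot, LinearEquiv.map_eq_zero_iff] at this
    exact congrArg Prod.fst this
  · right
    refine subsingleton_of_forall_eq 0 fun y => ?_
    have : e.symm (0, y) ∈ (Submodule.prod ⊥ ⊤ : Submodule Λ (X × Y)).comap e.toLinearMap := by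
      simp
    rw [h0, Submodule.mem_bot, LinearEquiv.map_eq_zero_iff] at this
    exact congrArg Prod.snd this

theorem IsIndecomposable.nonempty_equiv_of_isSummand {I J : FGModuleCat.{u} Λ}
    (hI : IsIndecomposable I) (hJ : IsIndecomposable J) (h : IsSummand I J) :
    Nonempty (I ≃ₗ[Λ] J) := by
  obtain ⟨Z, ⟨e⟩⟩ := h
  have := hI.1
  rcases hJ.subsingleton_of_equiv_prod e with h0 | h0
  · exact absurd h0 (not_subsingleton I)
  · have : Unique Z := uniqueOfSubsingleton 0
    exact ⟨(e ≪≫ₗ LinearEquiv.prodUnique).symm⟩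

variable [IsArtinianRing Λ]

/-- Every finitely generated module is built from indecomposable modules by direct sums. -/
theorem decomposition_induction {p : FGModuleCat.{u} Λ → Prop}
    (h0 : ∀ M : FGModuleCat.{u} Λ, Subsingleton M → p M)
    (h1 : ∀ M, IsIndecomposable M → p M)
    (h2 : ∀ M X Y : FGModuleCat.{u} Λ, (M ≃ₗ[Λ] (X × Y)) → p X → p Y → p M)
    (M : FGModuleCat.{u} Λ) : p M := by
  induction hl : Module.length Λ M using WellFoundedLT.induction generalizing M with
  | ind l ih =>
    by_cases hs : Subsingleton M
    · exact h0 M hs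
    by_cases hi : IsIndecomposable M
    · exact h1 M hi
    have hnt : Nontrivial M := not_subsingleton_iff_nontrivial.1 hs
    have : ∃ B C : Submodule Λ M, IsCompl B C ∧ B ≠ ⊥ ∧ C ≠ ⊥ := by
      by_contra hcon
      push Not at hcon
      exact hi ⟨hnt, fun B C hBC => or_iff_not_imp_left.2 (hcon B C hBC)⟩
    obtain ⟨B, C, hBC, hB, hC⟩ := this
    have key : ∀ B C : Submodule Λ M, IsCompl B C → C ≠ ⊥ → p (FGModuleCat.of Λ B) := by
      intro B C hBC hC
      refine ih _ ?_ _ rfl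
      rw [← hl]
      refine Submodule.length_lt fun hT => hC ?_
      rw [hT] at hBC
      exact disjoint_top.1 hBC.disjoint.symm
    exact h2 M (FGModuleCat.of Λ B) (FGModuleCat.of Λ C)
      (Submodule.prodEquivOfIsCompl B C hBC).symm (key B C hBC hC) (key C B hBC.symm hB)

/-- Fitting's lemma for indecomposable modules. -/
theorem IsIndecomposable.isUnit_or_isNilpotent {I : FGModuleCat.{u} Λ} (hI : IsIndecomposable I)
    (a : Module.End Λ I) : IsUnit a ∨ IsNilpotent a := by
  obtain ⟨k, hk⟩ := Filter.eventually_atTop.1 a.eventually_isCompl_ker_pow_range_pow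
  -- The exponent is taken positive so that invertibility of the power gives invertibility of `a`.
  have hc := hk (k + 1) (Nat.le_succ k)
  rcases hI.2 _ _ hc with h0 | h0
  · left
    rw [← isUnit_pow_iff (Nat.succ_ne_zero k), Module.End.isUnit_iff]
    refine ⟨LinearMap.ker_eq_bot.1 h0, LinearMap.range_eq_top.1 ?_⟩
    rw [h0] at hc
    simpa using hc.codisjoint
  · right
    exact ⟨k + 1, LinearMap.range_eq_bot.1 h0⟩

/-- An injective endomorphism of an artinian module is bijective. This makes `radHom` stable under
the action of `End I`. -/
theorem isUnit_right_of_mul_end {I : FGModuleCat.{u} Λ} {a b : Module.End Λ I} (h : IsUnit (a * b)) : IsUnit b := by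
  rw [Module.End.isUnit_iff] at h ⊢
  have hb : Function.Injective b := Function.Injective.of_comp h.1
  exact IsArtinian.bijective_of_injective_endomorphism b hb

/-- Locality of `End I`: after normalising the sum to `1`, Fitting leaves either an invertible first
summand or a nilpotent one, and `1` minus a nilpotent is a unit. -/
theorem IsIndecomposable.isUnit_or_isUnit_of_add {I : FGModuleCat.{u} Λ}
    (hI : IsIndecomposable I) {a b : Module.End Λ I} (h : IsUnit (a + b)) :
    IsUnit a ∨ IsUnit b := by
  obtain ⟨u, hu⟩ := h
  have h1 : (↑u⁻¹ : Module.End Λ I) * a + ↑u⁻¹ * b = 1 := by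
    rw [← mul_add, ← hu, Units.inv_mul]
  rcases hI.isUnit_or_isNilpotent (↑u⁻¹ * a) with ha | ha
  · exact Or.inl (by simpa using ha)
  · right
    have : IsUnit ((↑u⁻¹ : Module.End Λ I) * b) := by
      rw [← eq_sub_iff_add_eq'] at h1
      rw [h1]
      exact ha.isUnit_one_sub
    simpa using this

/-- The maps `M → I` in the radical of the module category. -/
def radHom {I : FGModuleCat.{u} Λ} (hI : IsIndecomposable I) (M : Type u) [AddCommGroup M]
    [Module Λ M] : Submodule (Module.End Λ I) (M →ₗ[Λ] I) where
  carrier := {f | ∀ g : I →ₗ[Λ] M, ¬ IsUnit (M := Module.End Λ I) (f ∘ₗ g)}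
  zero_mem' := fun g h => by
    have := hI.1
    rw [LinearMap.zero_comp] at h
    exact not_isUnit_zero (M₀ := Module.End Λ I) h
  add_mem' := fun {f f'} hf hf' g h => by
    rw [LinearMap.add_comp] at h
    exact (hI.isUnit_or_isUnit_of_add h).elim (hf g) (hf' g)
  smul_mem' := fun a f hf g h => hf g (isUnit_right_of_mul_end (a := a) h)

/-- The multiplicity of the indecomposable module `I` as a direct summand of `M`. -/
noncomputable def multLength {I : FGModuleCat.{u} Λ} (hI : IsIndecomposable I)
    (M : Type u) [AddCommGroup M] [Module Λ M] : ℕ∞ :=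
  Module.length (Module.End Λ I) ((M →ₗ[Λ] I) ⧸ radHom hI M)

/-- By locality of `End I`, a map out of `X ⊕ Y` is radical exactly when both of its restrictions
are, so the quotient by the radical splits as a product. -/
theorem multLength_prod {I : FGModuleCat.{u} Λ} (hI : IsIndecomposable I)
    {M X Y : FGModuleCat.{u} Λ} (e : M ≃ₗ[Λ] (X × Y)) :
    multLength hI M = multLength hI X + multLength hI Y := by
  let i : X →ₗ[Λ] M := e.symm.toLinearMap ∘ₗ LinearMap.inl Λ X Y
  let j : Y →ₗ[Λ] M := e.symm.toLinearMap ∘ₗ LinearMap.inr Λ X Y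
  let ri : (M →ₗ[Λ] I) →ₗ[Module.End Λ I] (X →ₗ[Λ] I) :=
    { toFun := fun f => f ∘ₗ i, map_add' := fun _ _ => rfl, map_smul' := fun _ _ => rfl }
  let rj : (M →ₗ[Λ] I) →ₗ[Module.End Λ I] (Y →ₗ[Λ] I) :=
    { toFun := fun f => f ∘ₗ j, map_add' := fun _ _ => rfl, map_smul' := fun _ _ => rfl }
  let φ : (M →ₗ[Λ] I) →ₗ[Module.End Λ I]
      (((X →ₗ[Λ] I) ⧸ radHom hI X) × ((Y →ₗ[Λ] I) ⧸ radHom hI Y)) :=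
    ((radHom hI X).mkQ ∘ₗ ri).prod ((radHom hI Y).mkQ ∘ₗ rj)
  have hdec : ∀ m, m = i (e m).1 + j (e m).2 := by
    intro m
    apply e.injective
    change e m = e (e.symm ((e m).1, 0) + e.symm (0, (e m).2))
    rw [map_add, e.apply_symm_apply, e.apply_symm_apply]
    simp
  have hsurj : Function.Surjective φ := by
    rintro ⟨a, b⟩
    obtain ⟨a, rfl⟩ := Submodule.mkQ_surjective _ a
    obtain ⟨b, rfl⟩ := Submodule.mkQ_surjective _ b
    have ha : ri (a.coprod b ∘ₗ e.toLinearMap) = a := by ext x; simp [ri, i]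
    have hb : rj (a.coprod b ∘ₗ e.toLinearMap) = b := by ext x; simp [rj, j]
    refine ⟨a.coprod b ∘ₗ e.toLinearMap, Prod.ext ?_ ?_⟩
    · exact congrArg (radHom hI X).mkQ ha
    · exact congrArg (radHom hI Y).mkQ hb
  have hker : LinearMap.ker φ = radHom hI M := by
    ext f
    rw [LinearMap.ker_prod, Submodule.mem_inf, LinearMap.ker_comp, LinearMap.ker_comp,
      Submodule.ker_mkQ, Submodule.ker_mkQ]
    constructor
    · rintro ⟨hX, hY⟩ g hg
      have : f ∘ₗ g = (f ∘ₗ i) ∘ₗ (LinearMap.fst Λ X Y ∘ₗ e.toLinearMap ∘ₗ g) +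
          (f ∘ₗ j) ∘ₗ (LinearMap.snd Λ X Y ∘ₗ e.toLinearMap ∘ₗ g) := by
        ext x
        have := congrArg f (hdec (g x))
        rw [map_add] at this
        exact this
      rw [this] at hg
      exact (hI.isUnit_or_isUnit_of_add hg).elim (hX _) (hY _)
    · intro hf
      exact ⟨fun g hg => hf (i ∘ₗ g) hg, fun g hg => hf (j ∘ₗ g) hg⟩
  rw [multLength, ← hker, (φ.quotKerEquivOfSurjective hsurj).length_eq, Module.length_prod]
  rfl

theorem multLength_of_subsingleton {I : FGModuleCat.{u} Λ} (hI : IsIndecomposable I)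
    (M : FGModuleCat.{u} Λ) [Subsingleton M] : multLength hI M = 0 := by
  have : Subsingleton (M →ₗ[Λ] I) := ⟨fun f g => by
    ext x; rw [Subsingleton.elim x 0, map_zero, map_zero]⟩
  have := Submodule.Quotient.subsingleton_iff (p := radHom hI M) |>.2 (Subsingleton.elim _ _)
  exact Module.length_eq_zero

/-- A map `f : M → I` outside the radical has some `f ∘ g` invertible, which splits `I` off `M`;
conversely the projection onto a summand `I` is not radical. -/
theorem multLength_ne_zero_iff {I : FGModuleCat.{u} Λ} (hI : IsIndecomposable I)
    (M : FGModuleCat.{u} Λ) : multLength hI M ≠ 0 ↔ IsSummand I M := by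
  rw [multLength, Ne, Module.length_eq_zero_iff, Submodule.Quotient.subsingleton_iff]
  constructor
  · intro h
    obtain ⟨f, hf⟩ : ∃ f, f ∉ radHom hI M := by
      by_contra hcon
      push Not at hcon
      exact h (eq_top_iff.2 fun f _ => hcon f)
    have : ∃ g : I →ₗ[Λ] M, IsUnit (M := Module.End Λ I) (f ∘ₗ g) := by
      by_contra hcon
      exact hf (not_exists.1 hcon)
    obtain ⟨g, ⟨v, hv⟩⟩ := this
    refine isSummand_of_leftInverse g ((↑v⁻¹ : Module.End Λ I) ∘ₗ f) fun x => ?_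
    have h1 : (↑v⁻¹ : Module.End Λ I) * (f ∘ₗ g) = 1 := by rw [← hv, Units.inv_mul]
    exact LinearMap.congr_fun h1 x
  · rintro ⟨Z, ⟨e⟩⟩ hT
    have : LinearMap.fst Λ I Z ∘ₗ e.toLinearMap ∈ radHom hI M := hT ▸ Submodule.mem_top
    refine this (e.symm.toLinearMap ∘ₗ LinearMap.inl Λ I Z) ?_
    convert isUnit_one (M := Module.End Λ I)
    ext x
    simp

/-- By additivity only indecomposable modules matter. One with nonzero multiplicity is isomorphic to
`I`, and there the quotient is simple, so the multiplicity is `1`. -/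
theorem multLength_ne_top {I : FGModuleCat.{u} Λ} (hI : IsIndecomposable I)
    (M : FGModuleCat.{u} Λ) : multLength hI M ≠ ⊤ := by
  refine decomposition_induction (p := fun M => multLength hI M ≠ ⊤) ?_ ?_ ?_ M
  · intro M hM
    rw [multLength_of_subsingleton]
    exact ENat.zero_ne_top
  · intro J hJ
    by_cases hz : multLength hI J = 0
    · rw [hz]
      exact ENat.zero_ne_top
    obtain ⟨e⟩ := hI.nonempty_equiv_of_isSummand hJ ((multLength_ne_zero_iff hI J).1 hz)
    have hs : IsSimpleModule (Module.End Λ I) ((J →ₗ[Λ] I) ⧸ radHom hI J) := by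
      rw [isSimpleModule_iff_toSpanSingleton_surjective]
      refine ⟨?_, ?_⟩
      · rw [← not_subsingleton_iff_nontrivial, ← Module.length_eq_zero_iff (R := Module.End Λ I)]
        exact hz
      intro x hx y
      obtain ⟨f, rfl⟩ := Submodule.mkQ_surjective _ x
      obtain ⟨h, rfl⟩ := Submodule.mkQ_surjective _ y
      have hf : f ∉ radHom hI J := fun h' => hx ((Submodule.Quotient.mk_eq_zero _).2 h')
      have : ∃ g : I →ₗ[Λ] J, IsUnit (M := Module.End Λ I) (f ∘ₗ g) := by
        by_contra hcon
        exact hf (not_exists.1 hcon)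
      obtain ⟨g, hg⟩ := this
      -- A map outside the radical is onto, so composed with `e` it is an invertible endomorphism.
      -- Hence `f` generates: any `h` equals `(h e)(f e)⁻¹ f`.
      have hfe : IsUnit (M := Module.End Λ I) (f ∘ₗ e.toLinearMap) := by
        have hsf : Function.Surjective (f ∘ₗ e.toLinearMap) :=
          Function.Surjective.comp (g := f)
            (Function.Surjective.of_comp (g := g) ((Module.End.isUnit_iff _).1 hg).2) e.surjective
        rw [Module.End.isUnit_iff]
        exact IsNoetherian.bijective_of_surjective_endomorphism _ hsf
      obtain ⟨v, hv⟩ := hfe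
      refine ⟨(h ∘ₗ e.toLinearMap : Module.End Λ I) * ↑v⁻¹, ?_⟩
      change (radHom hI J).mkQ _ = _
      congr 1
      ext x
      have h1 : (↑v⁻¹ : Module.End Λ I) * (f ∘ₗ e.toLinearMap) = 1 := by rw [← hv, Units.inv_mul]
      have h2 := LinearMap.congr_fun h1 (e.symm x)
      simp only [Module.End.mul_apply, LinearMap.comp_apply, LinearEquiv.coe_coe,
        LinearEquiv.apply_symm_apply, Module.End.one_apply] at h2
      change h (e ((↑v⁻¹ : Module.End Λ I) (f x))) = h x
      rw [h2, e.apply_symm_apply]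
    rw [multLength, Module.length_eq_one]
    exact ENat.one_ne_top
  · intro M X Y e hX hY
    rw [multLength_prod hI e]
    exact WithTop.add_ne_top.2 ⟨hX, hY⟩

theorem multLength_congr {I : FGModuleCat.{u} Λ} (hI : IsIndecomposable I)
    {M N : FGModuleCat.{u} Λ} (e : M ≃ₗ[Λ] N) : multLength hI M = multLength hI N := by
  rw [multLength_prod hI (Y := FGModuleCat.of Λ PUnit.{u + 1}) (e ≪≫ₗ
    (LinearEquiv.prodUnique (R := Λ) (M := N) (M₂ := PUnit.{u + 1})).symm),
    multLength_of_subsingleton hI (FGModuleCat.of Λ PUnit.{u + 1}), add_zero]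

/-- The multiplicity of an indecomposable module, as a homomorphism on the group `K`. -/
noncomputable def multHom {I : FGModuleCat.{u} Λ} (hI : IsIndecomposable I) : K Λ →+ ℤ :=
  QuotientAddGroup.lift (splitRelations Λ)
    (FreeAbelianGroup.lift (Quotient.lift
      (fun M : FGModuleCat.{u} Λ => ((multLength hI M).toNat : ℤ))
      (fun _ _ ⟨e⟩ => by rw [multLength_congr hI e])))
    (by
      refine (AddSubgroup.closure_le _).2 ?_
      rintro _ ⟨M, X, Y, ⟨e⟩, rfl⟩
      simp only [SetLike.mem_coe, AddMonoidHom.mem_ker, map_sub, FreeAbelianGroup.lift_apply_of]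
      change ((multLength hI M).toNat : ℤ) - ((multLength hI X).toNat : ℤ)
        - ((multLength hI Y).toNat : ℤ) = 0
      rw [multLength_prod hI e, ENat.toNat_add (multLength_ne_top hI X) (multLength_ne_top hI Y)]
      push_cast
      abel)

theorem multHom_cls {I : FGModuleCat.{u} Λ} (hI : IsIndecomposable I) (M : FGModuleCat.{u} Λ) :
    multHom hI (cls M) = ((multLength hI M).toNat : ℤ) :=
  FreeAbelianGroup.lift_apply_of _ _

/-- Finiteness of the multiplicity is essential here, since `toNat` would also send `⊤` to `0`. -/
theorem multHom_cls_ne_zero_iff {I : FGModuleCat.{u} Λ} (hI : IsIndecomposable I)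
    (M : FGModuleCat.{u} Λ) : multHom hI (cls M) ≠ 0 ↔ IsSummand I M := by
  rw [multHom_cls, ← multLength_ne_zero_iff hI, Nat.cast_ne_zero, Ne, ENat.toNat_eq_zero, not_or]
  exact and_iff_left (multLength_ne_top hI M)

/-- Indecomposable modules are prime with respect to direct sums. -/
theorem IsIndecomposable.isSummand_or_of_prod {I M X Y : FGModuleCat.{u} Λ}
    (hI : IsIndecomposable I) (h : IsSummand I M) (e : M ≃ₗ[Λ] (X × Y)) :
    IsSummand I X ∨ IsSummand I Y := by
  rw [← multLength_ne_zero_iff hI, multLength_prod hI e] at h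
  rw [← multLength_ne_zero_iff hI, ← multLength_ne_zero_iff hI]
  by_contra hcon
  push Not at hcon
  exact h (by rw [hcon.1, hcon.2, add_zero])

/-- Splitting off a maximal common direct summand. -/
theorem exists_common_summand (A B : FGModuleCat.{u} Λ) :
    ∃ W A' B' : FGModuleCat.{u} Λ, Nonempty (A ≃ₗ[Λ] (W × A')) ∧ Nonempty (B ≃ₗ[Λ] (W × B')) ∧
      ∀ I, IsIndecomposable I → IsSummand I A' → ¬ IsSummand I B' := by
  induction hl : Module.length Λ A using WellFoundedLT.induction generalizing A B with
  | ind l ih =>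
    by_cases hcom : ∃ I, IsIndecomposable I ∧ IsSummand I A ∧ IsSummand I B
    · obtain ⟨I, hI, ⟨A₁, ⟨e⟩⟩, ⟨B₁, ⟨e'⟩⟩⟩ := hcom
      have := hI.1
      have hlt : Module.length Λ A₁ < l := by
        rw [← hl, e.length_eq, Module.length_prod]
        exact ENat.lt_add_left Module.length_ne_top Module.length_pos
      obtain ⟨W, A', B', ⟨f⟩, ⟨f'⟩, h⟩ := ih _ hlt A₁ B₁ rfl
      exact ⟨FGModuleCat.of Λ (I × W), A', B',
        ⟨e ≪≫ₗ (LinearEquiv.refl Λ I).prodCongr f ≪≫ₗ (LinearEquiv.prodAssoc Λ I W A').symm⟩,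
        ⟨e' ≪≫ₗ (LinearEquiv.refl Λ I).prodCongr f' ≪≫ₗ (LinearEquiv.prodAssoc Λ I W B').symm⟩, h⟩
    · push Not at hcom
      exact ⟨FGModuleCat.of Λ PUnit.{u + 1}, A, B,
        ⟨(LinearEquiv.uniqueProd (R := Λ) (M := A) (M₂ := PUnit.{u + 1})).symm⟩,
        ⟨(LinearEquiv.uniqueProd (R := Λ) (M := B) (M₂ := PUnit.{u + 1})).symm⟩, hcom⟩

/-- Both `X` and `𝒫` are closed under summands, so an indecomposable outside them cannot occur in
any generator of `⟨X⟩`. -/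
theorem multHom_eq_zero_of_mem_bracket {I : FGModuleCat.{u} Λ} (hI : IsIndecomposable I)
    {X : Set (FGModuleCat.{u} Λ)} (hX : addClosure X = X) (hIX : I ∉ X ∪ projectives Λ)
    {x : K Λ} (hx : x ∈ bracket X) : multHom hI x = 0 := by
  have : bracket X ≤ (multHom hI).ker := by
    rw [bracket, AddSubgroup.closure_le]
    rintro _ ⟨M, hM, hMi, rfl⟩
    rw [SetLike.mem_coe, AddMonoidHom.mem_ker]
    by_contra hne
    have h := (multHom_cls_ne_zero_iff hI M).1 hne
    exact hIX (hM.imp (fun hM => mem_of_isSummand hX hM h)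
      (fun hM => mem_of_isSummand (addClosure_projectives Λ) hM h))
  exact this hx

/-- Two modules with the same class modulo `⟨𝒳⟩` differ by summands from `𝒳 ∪ 𝒫`. -/
theorem exists_equiv_prod_of_sub_mem_bracket {X : Set (FGModuleCat.{u} Λ)}
    (hX : addClosure X = X) {A B : FGModuleCat.{u} Λ} (h : cls A - cls B ∈ bracket X) :
    ∃ W A' B' : FGModuleCat.{u} Λ, Nonempty (A ≃ₗ[Λ] (W × A')) ∧ Nonempty (B ≃ₗ[Λ] (W × B')) ∧
      (∀ I, IsIndecomposable I → IsSummand I A' → I ∈ X ∪ projectives Λ) ∧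
      (∀ I, IsIndecomposable I → IsSummand I B' → I ∈ X ∪ projectives Λ) := by
  obtain ⟨W, A', B', ⟨e⟩, ⟨e'⟩, hd⟩ := exists_common_summand A B
  -- Outside `X ∪ 𝒫` the multiplicities in `A'` and `B'` coincide. As the two share no
  -- indecomposable summand, such an `I` can occur in neither.
  have key : ∀ I (hI : IsIndecomposable I), I ∉ X ∪ projectives Λ →
      multHom hI (cls A') = multHom hI (cls B') := by
    intro I hI hIX
    have := multHom_eq_zero_of_mem_bracket hI hX hIX h
    rw [cls_prod e, cls_prod e', map_sub, map_add, map_add] at this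
    linarith
  refine ⟨W, A', B', ⟨e⟩, ⟨e'⟩, fun I hI hs => ?_, fun I hI hs => ?_⟩
  · by_contra hIX
    have h1 := (multHom_cls_ne_zero_iff hI A').2 hs
    rw [key I hI hIX] at h1
    exact hd I hI hs ((multHom_cls_ne_zero_iff hI B').1 h1)
  · by_contra hIX
    have h1 := (multHom_cls_ne_zero_iff hI B').2 hs
    rw [← key I hI hIX] at h1
    exact hd I hI ((multHom_cls_ne_zero_iff hI A').1 h1) hs

end Decomposition

/-! ### Projective dimension and short exact sequences. -/

section ProjectiveDimension

open CategoryTheory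

variable {Λ : Type u} [Ring Λ]

/-- The default value in `pd` only concerns dimension `⊥`, that is, the zero module, for which both
sides hold. -/
theorem pd_le_iff (M : FGModuleCat.{u} Λ) (k : ℕ) :
    pd M ≤ k ↔ HasProjectiveDimensionLE M.obj k := by
  rw [← projectiveDimension_le_iff, pd]
  generalize projectiveDimension M.obj = d
  induction d with
  | bot => simp
  | coe d =>
    rw [WithBot.unbotD_coe]
    exact WithBot.coe_le_coe.symm

theorem exists_pd_le {M : FGModuleCat.{u} Λ} (h : pd M < ⊤) : ∃ k : ℕ, pd M ≤ k := by
  obtain ⟨k, hk⟩ := ENat.ne_top_iff_exists.1 h.ne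
  exact ⟨k, hk.symm.le⟩

theorem pd_lt_top_of_le {M : FGModuleCat.{u} Λ} {k : ℕ} (h : pd M ≤ k) : pd M < ⊤ :=
  lt_of_le_of_lt h (ENat.natCast_lt_top k)

theorem pd_le_zero_iff (M : FGModuleCat.{u} Λ) :
    pd M ≤ (0 : ℕ) ↔ Module.Projective Λ M := by
  rw [pd_le_iff, ← projective_iff_hasProjectiveDimensionLE_zero]
  exact (IsProjective.iff_projective (R := Λ) M).symm

theorem pd_le_of_isSummand {M N : FGModuleCat.{u} Λ} (h : IsSummand M N) : pd M ≤ pd N := by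
  obtain ⟨Z, ⟨e⟩⟩ := h
  have r : Retract M.obj N.obj :=
    { i := ModuleCat.ofHom (e.symm.toLinearMap ∘ₗ LinearMap.inl Λ M Z)
      r := ModuleCat.ofHom (LinearMap.fst Λ M Z ∘ₗ e.toLinearMap)
      retract := by
        rw [← ModuleCat.ofHom_comp]
        refine (congrArg ModuleCat.ofHom ?_).trans ModuleCat.ofHom_id
        ext x
        simp }
  rcases eq_top_or_lt_top (pd N) with hN | hN
  · exact hN ▸ le_top
  · obtain ⟨k, hk⟩ := ENat.ne_top_iff_exists.1 hN.ne
    have := (pd_le_iff N k).1 hk.ge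
    rw [← hk, pd_le_iff]
    exact r.hasProjectiveDimensionLT (k + 1)

theorem pd_congr {M N : FGModuleCat.{u} Λ} (e : M ≃ₗ[Λ] N) : pd M = pd N :=
  le_antisymm (pd_le_of_isSummand ((IsSummand.refl M).of_equiv (LinearEquiv.refl Λ M) e))
    (pd_le_of_isSummand ((IsSummand.refl N).of_equiv (LinearEquiv.refl Λ N) e.symm))

/-- There is a short exact sequence `0 → A → B → C → 0`. -/
def HasShortExact (A B C : FGModuleCat.{u} Λ) : Prop :=
  ∃ (f : A →ₗ[Λ] B) (g : B →ₗ[Λ] C),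
    Function.Injective f ∧ Function.Exact f g ∧ Function.Surjective g

theorem shortExact_of_linearMap {A B C : FGModuleCat.{u} Λ} {f : A →ₗ[Λ] B} {g : B →ₗ[Λ] C}
    (hf : Function.Injective f) (hfg : Function.Exact f g) (hg : Function.Surjective g) :
    (ShortComplex.mk (X₁ := A.obj) (X₂ := B.obj) (X₃ := C.obj) (ModuleCat.ofHom f)
      (ModuleCat.ofHom g) (by
        rw [← ModuleCat.ofHom_comp, hfg.linearMap_comp_eq_zero]; rfl)).ShortExact where
  exact := (ShortComplex.ShortExact.moduleCat_exact_iff_function_exact _).2 hfg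
  mono_f := (ModuleCat.mono_iff_injective _).2 hf
  epi_g := (ModuleCat.epi_iff_surjective _).2 hg

theorem HasShortExact.pd_right {A B C : FGModuleCat.{u} Λ} (h : HasShortExact A B C) {k : ℕ}
    (hA : pd A ≤ k) (hB : pd B ≤ (k + 1 : ℕ)) : pd C ≤ (k + 1 : ℕ) := by
  obtain ⟨f, g, hf, hfg, hg⟩ := h
  rw [pd_le_iff] at *
  exact (shortExact_of_linearMap hf hfg hg).hasProjectiveDimensionLT_X₃ (k + 1) hA hB

theorem HasShortExact.pd_left {A B C : FGModuleCat.{u} Λ} (h : HasShortExact A B C) {k : ℕ}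
    (hB : pd B ≤ k) (hC : pd C ≤ (k + 1 : ℕ)) : pd A ≤ k := by
  obtain ⟨f, g, hf, hfg, hg⟩ := h
  rw [pd_le_iff] at *
  exact (shortExact_of_linearMap hf hfg hg).hasProjectiveDimensionLT_X₁ (k + 1) hB hC

theorem HasShortExact.pd_middle {A B C : FGModuleCat.{u} Λ} (h : HasShortExact A B C) {k : ℕ}
    (hA : pd A ≤ k) (hC : pd C ≤ k) : pd B ≤ k := by
  obtain ⟨f, g, hf, hfg, hg⟩ := h
  rw [pd_le_iff] at *
  exact (shortExact_of_linearMap hf hfg hg).hasProjectiveDimensionLT_X₂ (k + 1) hA hC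

theorem hasShortExact_of_equiv_prod {M X Y : FGModuleCat.{u} Λ} (e : M ≃ₗ[Λ] (X × Y)) :
    HasShortExact X M Y := by
  refine ⟨e.symm.toLinearMap ∘ₗ LinearMap.inl Λ X Y, LinearMap.snd Λ X Y ∘ₗ e.toLinearMap,
    e.symm.injective.comp LinearMap.inl_injective, fun m => ?_,
    (LinearMap.snd_surjective (R := Λ) (M := X) (M₂ := Y)).comp e.surjective⟩
  constructor
  · intro h
    refine ⟨(e m).1, ?_⟩
    have h' : (e m).2 = 0 := h
    change e.symm ((e m).1, 0) = m
    rw [← h', Prod.mk.eta, e.symm_apply_apply]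
  · rintro ⟨x, rfl⟩
    simp

theorem pd_prod_le {M X Y : FGModuleCat.{u} Λ} (e : M ≃ₗ[Λ] (X × Y)) {k : ℕ}
    (hX : pd X ≤ k) (hY : pd Y ≤ k) : pd M ≤ k :=
  (hasShortExact_of_equiv_prod e).pd_middle hX hY

theorem pd_le_of_projective {M : FGModuleCat.{u} Λ} (h : Module.Projective Λ M) (k : ℕ) :
    pd M ≤ k :=
  ((pd_le_zero_iff M).2 h).trans (by exact_mod_cast Nat.zero_le k)

/-- If the block `Z → Z` of the monomorphism in `0 → Z ⊕ P → Z ⊕ Q → N → 0` is nilpotent, with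
`P` and `Q` projective, then `pd Z ≤ pd N`. -/
theorem pd_le_of_isNilpotent {Z P Q N : FGModuleCat.{u} Λ} (hP : Module.Projective Λ P)
    (hQ : Module.Projective Λ Q) {f : (Z × P) →ₗ[Λ] (Z × Q)} {g : (Z × Q) →ₗ[Λ] N}
    (hf : Function.Injective f) (hfg : Function.Exact f g) (hg : Function.Surjective g)
    (hnil : IsNilpotent (R := Module.End Λ Z)
      (LinearMap.fst Λ Z Q ∘ₗ f ∘ₗ LinearMap.inl Λ Z P)) {k : ℕ} (hN : pd N ≤ k) :
    pd Z ≤ k := by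
  let := HasExt.standard (ModuleCat.{u} Λ)
  let ZP : FGModuleCat.{u} Λ := FGModuleCat.of Λ (Z × P)
  let ZQ : FGModuleCat.{u} Λ := FGModuleCat.of Λ (Z × Q)
  have hS := shortExact_of_linearMap (A := ZP) (B := ZQ) (C := N) hf hfg hg
  rw [pd_le_iff] at hN ⊢
  have hP' : HasProjectiveDimensionLT P.obj 1 := (pd_le_iff P 0).1 ((pd_le_zero_iff P).2 hP)
  have hQ' : HasProjectiveDimensionLT Q.obj 1 := (pd_le_iff Q 0).1 ((pd_le_zero_iff Q).2 hQ)
  have hN' : HasProjectiveDimensionLT N.obj (k + 1) := hN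
  change HasProjectiveDimensionLT Z.obj (k + 1)
  rw [hasProjectiveDimensionLT_iff]
  intro i hi Y
  let F : ZP.obj ⟶ ZQ.obj := ModuleCat.ofHom f
  let iP : Z.obj ⟶ ZP.obj := ModuleCat.ofHom (LinearMap.inl Λ Z P)
  let pP : ZP.obj ⟶ Z.obj := ModuleCat.ofHom (LinearMap.fst Λ Z P)
  let iQ : Z.obj ⟶ ZQ.obj := ModuleCat.ofHom (LinearMap.inl Λ Z Q)
  let pQ : ZQ.obj ⟶ Z.obj := ModuleCat.ofHom (LinearMap.fst Λ Z Q)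
  let jQ : Q.obj ⟶ ZQ.obj := ModuleCat.ofHom (LinearMap.inr Λ Z Q)
  let qQ : ZQ.obj ⟶ Q.obj := ModuleCat.ofHom (LinearMap.snd Λ Z Q)
  have hid : 𝟙 ZQ.obj = pQ ≫ iQ + qQ ≫ jQ := by
    refine ModuleCat.hom_ext (LinearMap.ext fun x => ?_)
    change (x : Z × Q) = (x.1, 0) + (0, x.2)
    rw [Prod.mk_add_mk, add_zero, zero_add]
  have hret : iP ≫ pP = 𝟙 Z.obj := by
    refine ModuleCat.hom_ext (LinearMap.ext fun x => ?_)
    rfl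
  let a : Z.obj ⟶ Z.obj := iP ≫ F ≫ pQ
  have hsurj : ∀ y : Abelian.Ext Z.obj Y i, ∃ w : Abelian.Ext Z.obj Y i,
      (Abelian.Ext.mk₀ a).comp w (zero_add i) = y := by
    intro y
    -- Since `i > k ≥ pd N`, the group `Ext^(i+1)(N, Y)` vanishes, so every class on `Z ⊕ P` is
    -- pulled back along `f` from `Z ⊕ Q`.
    obtain ⟨w, hw⟩ := Abelian.Ext.contravariant_sequence_exact₁ hS Y
      ((Abelian.Ext.mk₀ pP).comp y (zero_add i)) (n₁ := i + 1) (add_comm 1 i)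
      (Abelian.Ext.eq_zero_of_hasProjectiveDimensionLT _ (k + 1) (by omega))
    change (Abelian.Ext.mk₀ F).comp w (zero_add i) = _ at hw
    refine ⟨(Abelian.Ext.mk₀ iQ).comp w (zero_add i), ?_⟩
    -- The degree satisfies `i ≥ 1`, so `Ext^i(Q, Y) = 0` and `w` is determined by its restriction
    -- to `Z`.
    have hw2 : w = (Abelian.Ext.mk₀ (pQ ≫ iQ)).comp w (zero_add i) := by
      have h1 : (Abelian.Ext.mk₀ (𝟙 ZQ.obj)).comp w (zero_add i) = w := by simp
      rw [hid, Abelian.Ext.mk₀_add, Abelian.Ext.add_comp,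
        ← Abelian.Ext.mk₀_comp_mk₀_assoc qQ jQ,
        ((Abelian.Ext.mk₀ jQ).comp w (zero_add i)).eq_zero_of_hasProjectiveDimensionLT 1 (by omega),
        Abelian.Ext.comp_zero, add_zero] at h1
      exact h1.symm
    have h2 : (Abelian.Ext.mk₀ iP).comp ((Abelian.Ext.mk₀ F).comp w (zero_add i)) (zero_add i)
        = y := by
      rw [hw, Abelian.Ext.mk₀_comp_mk₀_assoc, hret]
      simp
    rw [hw2] at h2
    simpa [a, Abelian.Ext.mk₀_comp_mk₀_assoc] using h2
  -- All powers of the block act surjectively on `Ext^i(Z, Y)`; a vanishing power then forces this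
  -- group to be zero.
  have hpow : ∀ (m : ℕ) (y : Abelian.Ext Z.obj Y i), ∃ w : Abelian.Ext Z.obj Y i,
      (Abelian.Ext.mk₀ (ModuleCat.ofHom
        ((LinearMap.fst Λ Z Q ∘ₗ f ∘ₗ LinearMap.inl Λ Z P : Module.End Λ Z) ^ m) :
          Z.obj ⟶ Z.obj)).comp w (zero_add i) = y := by
    intro m
    induction m with
    | zero => exact fun y => ⟨y, Abelian.Ext.mk₀_id_comp y⟩
    | succ m ih =>
      intro y
      obtain ⟨w, rfl⟩ := ih y
      obtain ⟨w, rfl⟩ := hsurj w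
      refine ⟨w, ?_⟩
      rw [Abelian.Ext.mk₀_comp_mk₀_assoc]
      rw [pow_succ']
      rfl
  obtain ⟨m, hm⟩ := hnil
  intro y
  obtain ⟨w, rfl⟩ := hpow m y
  rw [hm]
  change (Abelian.Ext.mk₀ (0 : Z.obj ⟶ Z.obj)).comp w (zero_add i) = 0
  rw [Abelian.Ext.mk₀_zero, Abelian.Ext.zero_comp]

end ProjectiveDimension

/-! ### Iterated syzygies and dimension shift. -/

section Syzygy

variable {Λ : Type u} [Ring Λ] [IsArtinAlgebra Λ]

theorem exists_shortExact_syzygy (M : FGModuleCat.{u} Λ) :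
    ∃ P : FGModuleCat.{u} Λ, Module.Projective Λ P ∧ HasShortExact (syzygy M) P M := by
  have h := (exists_projectiveCover M).choose_spec.choose_spec
  exact ⟨_, h.projective, (LinearMap.ker (exists_projectiveCover M).choose_spec.choose).subtype, _,
    Subtype.val_injective, LinearMap.exact_subtype_ker_map _, h.surjective⟩

theorem pd_syzygy_le_iff (M : FGModuleCat.{u} Λ) (k : ℕ) :
    pd (syzygy M) ≤ k ↔ pd M ≤ (k + 1 : ℕ) := by
  obtain ⟨P, hP, h⟩ := exists_shortExact_syzygy M
  exact ⟨fun hk => h.pd_right hk (pd_le_of_projective hP _),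
    fun hk => h.pd_left (pd_le_of_projective hP _) hk⟩

theorem pd_syzygy_iterate_le_iff (j : ℕ) (M : FGModuleCat.{u} Λ) (k : ℕ) :
    pd (syzygy^[j] M) ≤ k ↔ pd M ≤ (k + j : ℕ) := by
  induction j generalizing M with
  | zero => simp
  | succ j ih =>
    rw [Function.iterate_succ_apply, ih, pd_syzygy_le_iff, add_assoc]

/-- By dimension shift `Ω^k M` is projective; one more syzygy is needed to reach zero. -/
theorem subsingleton_syzygy_iterate {M : FGModuleCat.{u} Λ} {k : ℕ} (h : pd M ≤ k) :
    Subsingleton (syzygy^[k + 1] M) := by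
  rw [Function.iterate_succ_apply']
  apply subsingleton_syzygy
  rw [← pd_le_zero_iff, pd_syzygy_iterate_le_iff, zero_add]
  exact h

theorem syzygy_iterate_prod (k : ℕ) {M X Y : FGModuleCat.{u} Λ} (e : M ≃ₗ[Λ] (X × Y)) :
    Nonempty (syzygy^[k] M ≃ₗ[Λ] (syzygy^[k] X × syzygy^[k] Y)) := by
  induction k with
  | zero => exact ⟨e⟩
  | succ k ih =>
    rw [Function.iterate_succ_apply', Function.iterate_succ_apply', Function.iterate_succ_apply']
    exact ih.elim syzygy_prod

theorem IsSummand.syzygy_iterate {M N : FGModuleCat.{u} Λ} (h : IsSummand M N) (k : ℕ) :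
    IsSummand (syzygy^[k] M) (syzygy^[k] N) := by
  obtain ⟨Z, ⟨e⟩⟩ := h
  exact ⟨_, syzygy_iterate_prod k e⟩

theorem L_iterate_cls (k : ℕ) (M : FGModuleCat.{u} Λ) :
    (L Λ)^[k] (cls M) = cls (syzygy^[k] M) := by
  induction k with
  | zero => rfl
  | succ k ih => rw [Function.iterate_succ_apply', Function.iterate_succ_apply', ih, L_cls]

end Syzygy

/-! ### Cancelling invertible blocks in short exact sequences. -/

section Horseshoe

variable {Λ : Type u} [Ring Λ]

theorem HasShortExact.of_equiv {A B C A' B' C' : FGModuleCat.{u} Λ} (h : HasShortExact A B C)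
    (eA : A ≃ₗ[Λ] A') (eB : B ≃ₗ[Λ] B') (eC : C ≃ₗ[Λ] C') : HasShortExact A' B' C' := by
  obtain ⟨f, g, hf, hfg, hg⟩ := h
  refine ⟨eB.toLinearMap ∘ₗ f ∘ₗ eA.symm.toLinearMap, eC.toLinearMap ∘ₗ g ∘ₗ eB.symm.toLinearMap,
    eB.injective.comp (hf.comp eA.symm.injective), fun y => ?_,
    eC.surjective.comp (hg.comp eB.symm.surjective)⟩
  change eC (g (eB.symm y)) = 0 ↔ ∃ x, eB (f (eA.symm x)) = y
  rw [eC.map_eq_zero_iff, hfg]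
  constructor
  · rintro ⟨x, hx⟩
    exact ⟨eA x, by rw [eA.symm_apply_apply, hx, eB.apply_symm_apply]⟩
  · rintro ⟨x, rfl⟩
    exact ⟨eA.symm x, by rw [eB.symm_apply_apply]⟩

theorem isSummand_of_isCompl {M : FGModuleCat.{u} Λ} {A B : Submodule Λ M} (h : IsCompl A B)
    [Module.Finite Λ A] [Module.Finite Λ B] : IsSummand (FGModuleCat.of Λ A) M :=
  ⟨FGModuleCat.of Λ B, ⟨(Submodule.prodEquivOfIsCompl A B h).symm⟩⟩

/-- Elimination of an invertible block `A ≃ C` from a short exact sequence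
`0 → A ⊕ B → C ⊕ D → N → 0`. -/
theorem exact_of_eliminate {A B C D N : Type u} [AddCommGroup A] [Module Λ A] [AddCommGroup B]
    [Module Λ B] [AddCommGroup C] [Module Λ C] [AddCommGroup D] [Module Λ D] [AddCommGroup N]
    [Module Λ N] {f : (A × B) →ₗ[Λ] (C × D)} {g : (C × D) →ₗ[Λ] N} (u : A ≃ₗ[Λ] C)
    (hu : ∀ a, (f (a, 0)).1 = u a)
    (hf : Function.Injective f) (hfg : Function.Exact f g) (hg : Function.Surjective g) :
    ∃ (f' : B →ₗ[Λ] D) (g' : D →ₗ[Λ] N), Function.Injective f' ∧ Function.Exact f' g' ∧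
      Function.Surjective g' ∧ ∀ b, (f (0, b)).1 = 0 → f' b = (f (0, b)).2 := by
  -- Gaussian elimination: `c b` is the only `A`-coordinate for which `f (c b, b)` has zero
  -- `C`-component, so the part of the image of `f` inside `D` is parametrised by the graph of `c`.
  let c : B →ₗ[Λ] A := -(u.symm.toLinearMap ∘ₗ LinearMap.fst Λ C D ∘ₗ f ∘ₗ LinearMap.inr Λ A B)
  have hadd : ∀ a b, f (a, b) = f (a, 0) + f (0, b) := by
    intro a b
    rw [← map_add]
    simp
  have hc : ∀ b, (f (c b, b)).1 = 0 := by
    intro b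
    rw [hadd, Prod.fst_add, hu]
    change u (-(u.symm (f (0, b)).1)) + _ = 0
    rw [map_neg, u.apply_symm_apply, neg_add_cancel]
  have hca : ∀ a b, (f (a, b)).1 = 0 → a = c b := by
    intro a b h
    rw [hadd, Prod.fst_add, hu, ← eq_neg_iff_add_eq_zero] at h
    rw [← u.symm_apply_apply a, h, map_neg]
    rfl
  let f' : B →ₗ[Λ] D := LinearMap.snd Λ C D ∘ₗ f ∘ₗ c.prod LinearMap.id
  let g' : D →ₗ[Λ] N := g ∘ₗ LinearMap.inr Λ C D
  have hf' : ∀ b, f (c b, b) = (0, f' b) := fun b => Prod.ext (hc b) rfl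
  refine ⟨f', g', ?_, ?_, ?_, ?_⟩
  · rw [← LinearMap.ker_eq_bot, LinearMap.ker_eq_bot']
    intro b hb
    have := hf' b
    rw [hb] at this
    exact congrArg Prod.snd ((map_eq_zero_iff f hf).1 this)
  · intro d
    change g (0, d) = 0 ↔ _
    rw [hfg]
    constructor
    · rintro ⟨⟨a, b⟩, hab⟩
      obtain rfl := hca a b (congrArg Prod.fst hab)
      exact ⟨b, congrArg Prod.snd hab⟩
    · rintro ⟨b, rfl⟩
      exact ⟨(c b, b), hf' b⟩
  · intro n
    obtain ⟨⟨x, d⟩, rfl⟩ := hg n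
    -- Subtracting this element of the kernel of `g` clears the `C`-coordinate of a preimage of `n`.
    have h0 : g (f (u.symm x, 0)) = 0 := hfg.apply_apply_eq_zero _
    refine ⟨d - (f (u.symm x, 0)).2, ?_⟩
    change g (0, d - (f (u.symm x, 0)).2) = g (x, d)
    rw [← sub_zero (g (x, d)), ← h0, ← map_sub]
    congr 1
    refine Prod.ext ?_ rfl
    rw [Prod.fst_sub, hu, u.apply_symm_apply]
    exact (sub_self x).symm
  · intro b hb
    have h0 : c b = 0 := (hca 0 b hb).symm
    change (f (c b, b)).2 = _
    rw [h0]

variable [IsArtinianRing Λ]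

/-- The Fitting decomposition allows to replace `Z` by a direct summand for which the block
`Z → Z` is nilpotent. -/
theorem exists_summand_isNilpotent {Z P Q N : FGModuleCat.{u} Λ} {f : (Z × P) →ₗ[Λ] (Z × Q)}
    {g : (Z × Q) →ₗ[Λ] N}
    (hf : Function.Injective f) (hfg : Function.Exact f g) (hg : Function.Surjective g) :
    ∃ Z₁ : FGModuleCat.{u} Λ, IsSummand Z₁ Z ∧
      ∃ (f' : (Z₁ × P) →ₗ[Λ] (Z₁ × Q)) (g' : (Z₁ × Q) →ₗ[Λ] N),
        Function.Injective f' ∧ Function.Exact f' g' ∧ Function.Surjective g' ∧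
        IsNilpotent (R := Module.End Λ Z₁)
          (LinearMap.fst Λ Z₁ Q ∘ₗ f' ∘ₗ LinearMap.inl Λ Z₁ P) := by
  let a : Module.End Λ Z := LinearMap.fst Λ Z Q ∘ₗ f ∘ₗ LinearMap.inl Λ Z P
  obtain ⟨k, hk⟩ := Filter.eventually_atTop.1 a.eventually_isCompl_ker_pow_range_pow
  have hc := hk (k + 1) (Nat.le_succ k)
  set A : Submodule Λ Z := LinearMap.ker (a ^ (k + 1)) with hA
  set B : Submodule Λ Z := LinearMap.range (a ^ (k + 1)) with hB
  have hAa : ∀ x ∈ A, a x ∈ A := by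
    intro x hx
    rw [hA, LinearMap.mem_ker, ← Module.End.mul_apply, ← pow_succ, pow_succ',
      Module.End.mul_apply, LinearMap.mem_ker.1 hx, map_zero]
  have hBa : ∀ x ∈ B, a x ∈ B := by
    rintro _ ⟨x, rfl⟩
    exact ⟨a x, by rw [← Module.End.mul_apply, ← Module.End.mul_apply, ← pow_succ, ← pow_succ']⟩
  let aA : Module.End Λ A := a.restrict hAa
  let aB : Module.End Λ B := a.restrict hBa
  have hnil : aA ^ (k + 1) = 0 := by
    rw [Module.End.pow_restrict]
    ext x
    exact x.2
  have hinj : Function.Injective aB := by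
    rw [← LinearMap.ker_eq_bot, LinearMap.ker_eq_bot']
    intro x hx
    have hx' : a x = 0 := congrArg Subtype.val hx
    have hxA : (x : Z) ∈ A := by
      rw [hA, LinearMap.mem_ker, pow_succ, Module.End.mul_apply, hx', map_zero]
    exact Subtype.ext (Submodule.disjoint_def.1 hc.disjoint _ hxA x.2)
  let u : B ≃ₗ[Λ] B :=
    LinearEquiv.ofBijective aB (IsArtinian.bijective_of_injective_endomorphism aB hinj)
  -- Reordering puts the Fitting component `B`, on which `a` is invertible, first, ready for
  -- elimination.
  let E : ∀ (X : FGModuleCat.{u} Λ), (B × (A × X)) ≃ₗ[Λ] (Z × X) := fun X =>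
    (LinearEquiv.prodAssoc Λ B A X).symm ≪≫ₗ
      (Submodule.prodEquivOfIsCompl B A hc.symm).prodCongr (LinearEquiv.refl Λ X)
  have hE : ∀ (X : FGModuleCat.{u} Λ) (b : B) (x : A) (y : X),
      E X (b, (x, y)) = ((b : Z) + x, y) := fun X b x y => rfl
  have h1 : ∀ b : B, (E Q).symm (f (E P (b, 0))) = (aB b, (0, (f ((b : Z), 0)).2)) := by
    intro b
    rw [LinearEquiv.symm_apply_eq, hE]
    change f ((b : Z) + ((0 : A) : Z), 0) = _
    rw [Submodule.coe_zero, add_zero, hE, Submodule.coe_zero, add_zero]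
    rfl
  -- Since `a` preserves `A`, elements of `A` have no `B`-component under `f`, so elimination leaves
  -- their images unchanged and the new block is the nilpotent `aA`.
  have h2 : ∀ x : A, (E Q).symm (f (E P (0, (x, 0)))) = (0, (aA x, (f ((x : Z), 0)).2)) := by
    intro x
    rw [LinearEquiv.symm_apply_eq, hE, hE, Submodule.coe_zero, zero_add, zero_add]
    rfl
  obtain ⟨f', g', hf', hfg', hg', hval⟩ := exact_of_eliminate
    (f := (E Q).symm.toLinearMap ∘ₗ f ∘ₗ (E P).toLinearMap) (g := g ∘ₗ (E Q).toLinearMap) u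
    (fun b => congrArg Prod.fst (h1 b))
    ((E Q).symm.injective.comp (hf.comp (E P).injective))
    (by
      intro y
      change g (E Q y) = 0 ↔ ∃ x, (E Q).symm (f (E P x)) = y
      rw [hfg]
      constructor
      · rintro ⟨x, hx⟩
        exact ⟨(E P).symm x, by rw [LinearEquiv.apply_symm_apply, hx, LinearEquiv.symm_apply_apply]⟩
      · rintro ⟨x, rfl⟩
        exact ⟨E P x, by rw [LinearEquiv.apply_symm_apply]⟩)
    (hg.comp (E Q).surjective)
  refine ⟨FGModuleCat.of Λ A, isSummand_of_isCompl hc, f', g', hf', hfg', hg', k + 1, ?_⟩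
  rw [← hnil]
  congr 1
  ext x
  have h3 := hval (x, 0) (congrArg Prod.fst (h2 x))
  have h4 : f' (x, 0) = (aA x, (f ((x : Z), 0)).2) := h3.trans (congrArg Prod.snd (h2 x))
  change ((f' (x, 0)).1 : Z) = aA x
  rw [h4]

end Horseshoe

/-! ### The horseshoe lemma. -/

section Syzygy

variable {Λ : Type u} [Ring Λ] [IsArtinAlgebra Λ]

/-- The map `f` factors through the projective cover `p` by some `h`, which is onto because `ker p`
is superfluous. A section of `h` then splits `ker f` into `ker p` and the projective module `ker h`.
-/
theorem exists_ker_equiv_syzygy_prod {Q M : FGModuleCat.{u} Λ} (hQ : Module.Projective Λ Q)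
    {f : Q →ₗ[Λ] M} (hf : Function.Surjective f) :
    ∃ P : FGModuleCat.{u} Λ, Module.Projective Λ P ∧
      Nonempty (LinearMap.ker f ≃ₗ[Λ] (syzygy M × P)) := by
  obtain ⟨R, p, hp⟩ := exists_projectiveCover M
  have := hp.projective
  obtain ⟨h, hh⟩ := Module.projective_lifting_property p f hp.surjective
  have hph : ∀ x, p (h x) = f x := fun x => LinearMap.congr_fun hh x
  have hsurj : Function.Surjective h := by
    rw [← LinearMap.range_eq_top]
    apply hp.superfluous
    rw [eq_top_iff]
    intro q _
    obtain ⟨x, hx⟩ := hf (p q)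
    refine Submodule.mem_sup.2 ⟨h x, ⟨x, rfl⟩, q - h x, ?_, by abel⟩
    rw [LinearMap.mem_ker, map_sub, hph, hx, sub_self]
  obtain ⟨s, hs⟩ := Module.projective_lifting_property h LinearMap.id hsurj
  have hs' : ∀ q, h (s q) = q := fun q => LinearMap.congr_fun hs q
  obtain ⟨eΩ⟩ := syzygy_equiv_ker hp
  have hfs : ∀ r, f (s r) = p r := fun r => by rw [← hph, hs']
  let π : Q →ₗ[Λ] LinearMap.ker h := (LinearMap.id - s ∘ₗ h).codRestrict _ (fun x => by
    rw [LinearMap.mem_ker]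
    change h (x - s (h x)) = 0
    rw [map_sub, hs', sub_self])
  have hproj : Module.Projective Λ (LinearMap.ker h) := by
    refine Module.Projective.of_split (LinearMap.ker h).subtype π ?_
    ext x
    change (x : Q) - s (h x) = x
    rw [LinearMap.mem_ker.1 x.2, map_zero, sub_zero]
  refine ⟨FGModuleCat.of Λ (LinearMap.ker h), hproj, ⟨?_ ≪≫ₗ
    eΩ.symm.prodCongr (LinearEquiv.refl Λ (LinearMap.ker h))⟩⟩
  exact
    { toFun := fun x => (⟨h x, by rw [LinearMap.mem_ker, hph]; exact x.2⟩, π x)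
      map_add' := fun x y => Prod.ext (Subtype.ext (map_add h _ _)) (map_add π _ _)
      map_smul' := fun c x => Prod.ext (Subtype.ext (map_smul h c _)) (map_smul π c _)
      invFun := fun y => ⟨s y.1 + y.2, by
        have h1 : p y.1 = 0 := y.1.2
        have h2 : h y.2 = 0 := y.2.2
        rw [LinearMap.mem_ker, map_add, hfs, h1, ← hph, h2, map_zero, add_zero]⟩
      left_inv := fun x => Subtype.ext (by
        change s (h x) + ((x : Q) - s (h x)) = x
        abel)
      right_inv := fun y => by
        have h2 : h y.2 = 0 := y.2.2
        refine Prod.ext (Subtype.ext ?_) (Subtype.ext ?_)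
        · change h (s y.1 + y.2) = y.1
          rw [map_add, hs', h2, add_zero]
        · change (s y.1 + y.2 : Q) - s (h (s y.1 + y.2)) = y.2
          rw [map_add, hs', h2, add_zero, add_sub_cancel_left] }

/-- The horseshoe lemma for syzygies. -/
theorem HasShortExact.syzygy {A B C : FGModuleCat.{u} Λ} (h : HasShortExact A B C) :
    ∃ P : FGModuleCat.{u} Λ, Module.Projective Λ P ∧
      HasShortExact (syzygy A) (FGModuleCat.of Λ (LatIgusaTodorov.syzygy B × P)) (syzygy C) := by
  obtain ⟨f, g, hf, hfg, hg⟩ := h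
  obtain ⟨PA, p, hp⟩ := exists_projectiveCover A
  obtain ⟨PC, q, hq⟩ := exists_projectiveCover C
  have := hp.projective
  have := hq.projective
  obtain ⟨s, hs⟩ := Module.projective_lifting_property g q hg
  have hs' : ∀ y, g (s y) = q y := fun y => LinearMap.congr_fun hs y
  have hgf : ∀ a, g (f a) = 0 := hfg.apply_apply_eq_zero
  let r : (PA × PC) →ₗ[Λ] B := (f ∘ₗ p).coprod s
  have hr : ∀ x y, r (x, y) = f (p x) + s y := fun x y => rfl
  have hrs : Function.Surjective r := by
    intro b
    obtain ⟨y, hy⟩ := hq.surjective (g b)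
    obtain ⟨a, ha⟩ := (hfg (b - s y)).1 (by rw [map_sub, hs', hy, sub_self])
    obtain ⟨x, rfl⟩ := hp.surjective a
    exact ⟨(x, y), by rw [hr, ha, sub_add_cancel]⟩
  -- The sum of two projective covers need not cover `B` minimally; `P` is the excess.
  obtain ⟨P, hP, ⟨e⟩⟩ := exists_ker_equiv_syzygy_prod (Q := FGModuleCat.of Λ (PA × PC))
    (inferInstanceAs (Module.Projective Λ (PA × PC))) hrs
  obtain ⟨eA⟩ := syzygy_equiv_ker hp
  obtain ⟨eC⟩ := syzygy_equiv_ker hq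
  let i : LinearMap.ker p →ₗ[Λ] LinearMap.ker r :=
    (LinearMap.inl Λ PA PC ∘ₗ (LinearMap.ker p).subtype).codRestrict _ (fun x => by
      have hx : p x = 0 := x.2
      rw [LinearMap.mem_ker]
      change r (x, 0) = 0
      rw [hr, hx, map_zero, map_zero, add_zero])
  let j : LinearMap.ker r →ₗ[Λ] LinearMap.ker q :=
    (LinearMap.snd Λ PA PC ∘ₗ (LinearMap.ker r).subtype).codRestrict _ (fun x => by
      have hx : g (f (p x.1.1) + s x.1.2) = 0 := by rw [← hr, Prod.mk.eta, x.2, map_zero]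
      rw [map_add, hgf, zero_add, hs'] at hx
      exact hx)
  have hse : HasShortExact (FGModuleCat.of Λ (LinearMap.ker p))
      (FGModuleCat.of Λ (LinearMap.ker r)) (FGModuleCat.of Λ (LinearMap.ker q)) := by
    refine ⟨i, j, ?_, ?_, ?_⟩
    · intro x y hxy
      exact Subtype.ext (congrArg (fun z => z.1.1) hxy)
    · rintro ⟨⟨x, y⟩, hxy⟩
      constructor
      · intro h0
        have hy : y = 0 := congrArg Subtype.val h0
        subst hy
        have hx : p x = 0 := by
          rw [LinearMap.mem_ker, hr, map_zero, add_zero] at hxy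
          exact (map_eq_zero_iff f hf).1 hxy
        exact ⟨⟨x, hx⟩, rfl⟩
      · rintro ⟨x', hx'⟩
        exact Subtype.ext (congrArg (fun z => z.1.2) hx').symm
    · rintro ⟨y, hy⟩
      -- For `y` in `ker q` the lift `s y` comes from `A`, and a preimage in `PA` corrects it to an
      -- element of `ker r`.
      obtain ⟨a, ha⟩ := (hfg (s y)).1 (by rw [hs']; exact hy)
      obtain ⟨x, rfl⟩ := hp.surjective a
      refine ⟨⟨(-x, y), ?_⟩, rfl⟩
      rw [LinearMap.mem_ker, hr, map_neg, map_neg, ha, neg_add_cancel]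
  exact ⟨P, hP, hse.of_equiv eA.symm e eC.symm⟩

/-- The projective excess of one step vanishes at the next syzygy, so a single correction term
suffices for all `k`. -/
theorem HasShortExact.syzygy_iterate (k : ℕ) {A B C : FGModuleCat.{u} Λ}
    (h : HasShortExact A B C) :
    ∃ P : FGModuleCat.{u} Λ, Module.Projective Λ P ∧
      HasShortExact (LatIgusaTodorov.syzygy^[k] A)
        (FGModuleCat.of Λ (LatIgusaTodorov.syzygy^[k] B × P)) (LatIgusaTodorov.syzygy^[k] C) := by
  induction k with
  | zero =>
    refine ⟨FGModuleCat.of Λ PUnit.{u + 1}, inferInstanceAs (Module.Projective Λ PUnit.{u + 1}),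
      h.of_equiv (LinearEquiv.refl Λ A) ?_ (LinearEquiv.refl Λ C)⟩
    exact (LinearEquiv.prodUnique (R := Λ) (M := B) (M₂ := PUnit.{u + 1})).symm
  | succ k ih =>
    obtain ⟨P, hP, h⟩ := ih
    obtain ⟨P', hP', h'⟩ := h.syzygy
    obtain ⟨e⟩ := syzygy_prod (M := FGModuleCat.of Λ (LatIgusaTodorov.syzygy^[k] B × P))
      (LinearEquiv.refl Λ _)
    have := subsingleton_syzygy hP
    have : Unique (LatIgusaTodorov.syzygy P) := uniqueOfSubsingleton 0
    rw [Function.iterate_succ_apply', Function.iterate_succ_apply', Function.iterate_succ_apply']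
    exact ⟨P', hP', h'.of_equiv (LinearEquiv.refl Λ _)
      ((e ≪≫ₗ LinearEquiv.prodUnique).prodCongr (LinearEquiv.refl Λ P')) (LinearEquiv.refl Λ _)⟩

end Syzygy

/-! ### Stabilisation of an endomorphism on a finitely generated subgroup. -/

section Eta

variable {G : Type*} [AddCommGroup G]

/-- The kernels of the powers of `f` on `X` form an ascending chain, which stabilises because `X` is
a noetherian `ℤ`-module. Thus the infimum defining `eta` is attained and is not the value `0` of an
empty infimum. -/
theorem bijOn_of_eta_le (f : G →+ G) {X : AddSubgroup G} (hX : X.FG) {m : ℕ}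
    (hm : eta f X ≤ m) : Set.BijOn f (f^[m] '' (X : Set G)) (f^[m + 1] '' (X : Set G)) := by
  have hne : {k : ℕ | ∀ m ≥ k, Set.BijOn f (f^[m] '' (X : Set G))
      (f^[m + 1] '' (X : Set G))}.Nonempty := by
    let F : Module.End ℤ G := f.toIntLinearMap
    have hF : ∀ (m : ℕ) (x : G), (F ^ m) x = f^[m] x := fun m x => Module.End.pow_apply F m x
    have hfin : Module.Finite ℤ X :=
      Module.Finite.iff_addGroup_fg.2 ((AddGroup.fg_iff_addSubgroup_fg X).2 hX)
    let c : ℕ →o Submodule ℤ X :=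
      { toFun := fun m => LinearMap.ker ((F ^ m) ∘ₗ X.subtype.toIntLinearMap)
        monotone' := by
          refine monotone_nat_of_le_succ fun m x hx => ?_
          have hx' : (F ^ m) (x : G) = 0 := hx
          change (F ^ (m + 1)) (x : G) = 0
          rw [pow_succ', Module.End.mul_apply, hx', map_zero] }
    obtain ⟨k, hk⟩ := monotone_stabilizes_iff_noetherian.2 (inferInstanceAs (IsNoetherian ℤ X)) c
    refine ⟨k, fun m hm => ⟨?_, ?_, ?_⟩⟩
    · rintro _ ⟨x, hx, rfl⟩
      exact ⟨x, hx, Function.iterate_succ_apply' f m x⟩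
    · rintro _ ⟨x, hx, rfl⟩ _ ⟨y, hy, rfl⟩ hxy
      have hc : c (m + 1) = c m := (hk (m + 1) (by omega)).symm.trans (hk m hm)
      have h1 : (⟨x - y, X.sub_mem hx hy⟩ : X) ∈ c (m + 1) := by
        change (F ^ (m + 1)) (x - y) = 0
        rw [map_sub, hF, hF, Function.iterate_succ_apply', Function.iterate_succ_apply', hxy,
          sub_self]
      rw [hc] at h1
      have h2 : (F ^ m) (x - y) = 0 := h1
      rw [map_sub, hF, hF] at h2
      exact sub_eq_zero.1 h2
    · rintro _ ⟨x, hx, rfl⟩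
      exact ⟨_, ⟨x, hx, rfl⟩, (Function.iterate_succ_apply' f m x).symm⟩
  exact Nat.sInf_mem hne m hm

/-- Beyond `eta f X`, iterating `f` is injective on the images of `X`. -/
theorem iterate_eta_eq_of_iterate_eq (f : G →+ G) {X : AddSubgroup G} (hX : X.FG) {x y : G}
    (hx : x ∈ X) (hy : y ∈ X) (n : ℕ) (h : f^[eta f X + n] x = f^[eta f X + n] y) :
    f^[eta f X] x = f^[eta f X] y := by
  induction n with
  | zero => exact h
  | succ n ih =>
    apply ih
    refine (bijOn_of_eta_le f hX (Nat.le_add_right _ n)).injOn ⟨x, hx, rfl⟩ ⟨y, hy, rfl⟩ ?_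
    rw [← Function.iterate_succ_apply' f, ← Function.iterate_succ_apply' f]
    exact h

theorem eta_eq_zero_of_injective {f : G →+ G} (hf : Function.Injective f) (X : AddSubgroup G) :
    eta f X = 0 := by
  refine Nat.sInf_eq_zero.2 (Or.inl fun m _ => ⟨?_, hf.injOn, ?_⟩)
  · rintro _ ⟨x, hx, rfl⟩
    exact ⟨x, hx, Function.iterate_succ_apply' f m x⟩
  · rintro _ ⟨x, hx, rfl⟩
    exact ⟨_, ⟨x, hx, rfl⟩, (Function.iterate_succ_apply' f m x).symm⟩

end Eta

/-! ### Additive closures and finiteness of indecomposable summands. -/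

section AddClosure

variable {Λ : Type u} [Ring Λ]

theorem mem_of_subsingleton {X : Set (FGModuleCat.{u} Λ)} (hX : addClosure X = X)
    (M : FGModuleCat.{u} Λ) [Subsingleton M] : M ∈ X := by
  rw [← hX]
  exact ⟨0, fun _ => M, fun i => i.elim0, M,
    ⟨LinearEquiv.ofSubsingleton (Fin 0 → M) (M × M)⟩⟩

theorem prod_mem {X : Set (FGModuleCat.{u} Λ)} (hX : addClosure X = X)
    {M N : FGModuleCat.{u} Λ} (hM : M ∈ X) (hN : N ∈ X) : FGModuleCat.of Λ (M × N) ∈ X := by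
  rw [← hX]
  let F : Fin 2 → FGModuleCat.{u} Λ := Fin.cons M (fun _ => N)
  refine ⟨2, F, fun i => ?_, ?_⟩
  · refine Fin.cases ?_ (fun _ => ?_) i
    · exact hM
    · exact hN
  · exact (IsSummand.refl (FGModuleCat.of Λ (∀ i, F i))).of_equiv
      (N' := FGModuleCat.of Λ (∀ i, F i)) (M' := FGModuleCat.of Λ (M × N))
      (LinearEquiv.piFinTwo Λ (fun i => F i)) (LinearEquiv.refl Λ (∀ i, F i))

theorem mem_addClosure_of_isSummand {X : Set (FGModuleCat.{u} Λ)} {M N : FGModuleCat.{u} Λ}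
    (h : IsSummand M N) (hN : N ∈ addClosure X) : M ∈ addClosure X := by
  obtain ⟨k, F, hF, hs⟩ := hN
  exact ⟨k, F, hF, h.trans hs⟩

/-- Every element of `K` is a difference of two classes. -/
theorem exists_eq_cls_sub_cls (x : K Λ) : ∃ A B : FGModuleCat.{u} Λ, x = cls A - cls B := by
  obtain ⟨y, rfl⟩ := QuotientAddGroup.mk_surjective x
  have hz : cls (FGModuleCat.of Λ PUnit.{u + 1}) = 0 := cls_eq_zero _
  induction y using FreeAbelianGroup.induction_on with
  | zero => exact ⟨FGModuleCat.of Λ PUnit.{u + 1}, FGModuleCat.of Λ PUnit.{u + 1},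
      (sub_self _).symm⟩
  | of M =>
    induction M using Quotient.inductionOn with
    | h M => exact ⟨M, FGModuleCat.of Λ PUnit.{u + 1}, by rw [hz, sub_zero]; rfl⟩
  | neg M ih =>
    obtain ⟨A, B, h⟩ := ih
    exact ⟨B, A, by rw [QuotientAddGroup.mk_neg, h, neg_sub]⟩
  | add y z hy hz =>
    obtain ⟨A, B, h⟩ := hy
    obtain ⟨A', B', h'⟩ := hz
    refine ⟨FGModuleCat.of Λ (A × A'), FGModuleCat.of Λ (B × B'), ?_⟩
    rw [QuotientAddGroup.mk_add, h, h',
      cls_prod (M := FGModuleCat.of Λ (A × A')) (LinearEquiv.refl Λ (A × A')),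
      cls_prod (M := FGModuleCat.of Λ (B × B')) (LinearEquiv.refl Λ (B × B'))]
    abel

variable [IsArtinianRing Λ]

/-- Only closure of `addClosure X` under summands is used, so idempotence of `addClosure` need not
be known. -/
theorem cls_mem_bracket_addClosure {X : Set (FGModuleCat.{u} Λ)} {M : FGModuleCat.{u} Λ}
    (hM : M ∈ addClosure X) : cls M ∈ bracket (addClosure X) := by
  refine decomposition_induction (p := fun M => M ∈ addClosure X →
    cls M ∈ bracket (addClosure X)) ?_ ?_ ?_ M hM
  · intro M _ _
    rw [cls_eq_zero]
    exact zero_mem _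
  · intro M hMi hM
    exact AddSubgroup.subset_closure ⟨M, Or.inl hM, hMi, rfl⟩
  · intro M A B e hA hB hM
    rw [cls_prod e]
    exact add_mem (hA (mem_addClosure_of_isSummand (isSummand_left e) hM))
      (hB (mem_addClosure_of_isSummand (isSummand_right e) hM))

theorem cls_mem_bracket_of_projective (X : Set (FGModuleCat.{u} Λ)) {M : FGModuleCat.{u} Λ}
    (hM : Module.Projective Λ M) : cls M ∈ bracket X := by
  have h := cls_mem_bracket_addClosure (X := projectives Λ) (subset_addClosure _ hM)
  rw [addClosure_projectives] at h
  refine AddSubgroup.closure_mono ?_ h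
  rintro _ ⟨N, hN, hNi, rfl⟩
  exact ⟨N, Or.inr (hN.elim id id), hNi, rfl⟩

/-- A module has only finitely many indecomposable direct summands up to isomorphism. -/
theorem exists_finite_indecomposable_summands (M : FGModuleCat.{u} Λ) :
    ∃ S : Set (FGModuleCat.{u} Λ), S.Finite ∧
      ∀ I, IsIndecomposable I → IsSummand I M → ∃ J ∈ S, Nonempty (I ≃ₗ[Λ] J) := by
  refine decomposition_induction (p := fun M => ∃ S : Set (FGModuleCat.{u} Λ), S.Finite ∧
      ∀ I, IsIndecomposable I → IsSummand I M → ∃ J ∈ S, Nonempty (I ≃ₗ[Λ] J)) ?_ ?_ ?_ M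
  · intro M hM
    refine ⟨∅, Set.finite_empty, fun I hI hs => absurd hs ?_⟩
    rw [← multLength_ne_zero_iff hI, not_not]
    exact multLength_of_subsingleton hI M
  · intro M hM
    exact ⟨{M}, Set.finite_singleton M, fun I hI hs =>
      ⟨M, rfl, hI.nonempty_equiv_of_isSummand hM hs⟩⟩
  · rintro M X Y e ⟨S, hS, h⟩ ⟨T, hT, h'⟩
    refine ⟨S ∪ T, hS.union hT, fun I hI hs => ?_⟩
    rcases hI.isSummand_or_of_prod hs e with h1 | h1
    · obtain ⟨J, hJ, e⟩ := h I hI h1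
      exact ⟨J, Or.inl hJ, e⟩
    · obtain ⟨J, hJ, e⟩ := h' I hI h1
      exact ⟨J, Or.inr hJ, e⟩

theorem exists_equiv_prod_of_summands_mem {X : Set (FGModuleCat.{u} Λ)} (hX : addClosure X = X)
    (M : FGModuleCat.{u} Λ)
    (h : ∀ I, IsIndecomposable I → IsSummand I M → I ∈ X ∪ projectives Λ) :
    ∃ D ∈ X, ∃ P ∈ projectives Λ, Nonempty (M ≃ₗ[Λ] (D × P)) := by
  refine decomposition_induction (p := fun M =>
    (∀ I, IsIndecomposable I → IsSummand I M → I ∈ X ∪ projectives Λ) →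
      ∃ D ∈ X, ∃ P ∈ projectives Λ, Nonempty (M ≃ₗ[Λ] (D × P))) ?_ ?_ ?_ M h
  · intro M hM _
    exact ⟨M, mem_of_subsingleton hX M, M, mem_of_subsingleton (addClosure_projectives Λ) M,
      ⟨LinearEquiv.ofSubsingleton M (M × M)⟩⟩
  · intro M hM hs
    rcases hs M hM (IsSummand.refl M) with h | h
    · exact ⟨M, h, FGModuleCat.of Λ PUnit.{u + 1},
        mem_of_subsingleton (addClosure_projectives Λ) (FGModuleCat.of Λ PUnit.{u + 1}),
        ⟨(LinearEquiv.prodUnique (R := Λ) (M := M) (M₂ := PUnit.{u + 1})).symm⟩⟩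
    · exact ⟨FGModuleCat.of Λ PUnit.{u + 1},
        mem_of_subsingleton hX (FGModuleCat.of Λ PUnit.{u + 1}), M, h,
        ⟨(LinearEquiv.uniqueProd (R := Λ) (M := M) (M₂ := PUnit.{u + 1})).symm⟩⟩
  · intro M A B e hA hB hs
    obtain ⟨D, hD, P, hP, ⟨f⟩⟩ := hA fun I hI h => hs I hI (h.trans (isSummand_left e))
    obtain ⟨D', hD', P', hP', ⟨f'⟩⟩ := hB fun I hI h => hs I hI (h.trans (isSummand_right e))
    exact ⟨_, prod_mem hX hD hD', _, prod_mem (addClosure_projectives Λ) hP hP',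
      ⟨e ≪≫ₗ f.prodCongr f' ≪≫ₗ LinearEquiv.prodProdProdComm Λ D P D' P'⟩⟩

theorem pd_le_of_indecomposable_summands (M : FGModuleCat.{u} Λ) {k : ℕ}
    (h : ∀ I, IsIndecomposable I → IsSummand I M → pd I ≤ k) : pd M ≤ k := by
  refine decomposition_induction (p := fun M =>
    (∀ I, IsIndecomposable I → IsSummand I M → pd I ≤ k) → pd M ≤ k) ?_ ?_ ?_ M h
  · intro M hM _
    exact pd_le_of_projective (mem_of_subsingleton (addClosure_projectives Λ) M) k
  · intro M hM hs
    exact hs M hM (IsSummand.refl M)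
  · intro M X Y e hX hY hs
    exact pd_prod_le e (hX fun I hI h => hs I hI (h.trans (isSummand_left e)))
      (hY fun I hI h => hs I hI (h.trans (isSummand_right e)))

/-- The projective dimension of a summand is controlled by those of its indecomposable summands, and
up to isomorphism only finitely many of these occur in `X`. -/
theorem finDimClass_summands_lt_top (X : FGModuleCat.{u} Λ) :
    finDimClass {Z | IsSummand Z X} < ⊤ := by
  obtain ⟨S, hS, h⟩ := exists_finite_indecomposable_summands X
  -- Here `toNat` turns infinite dimensions into `0`; this is harmless, as the bound is used only
  -- for `J` with `pd J` finite.
  obtain ⟨b, hb⟩ := (hS.image fun J => (pd J).toNat).bddAbove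
  refine lt_of_le_of_lt (b := (b : ℕ∞)) ?_ (ENat.natCast_lt_top b)
  refine iSup₂_le fun Z hZ => iSup_le fun hpd => ?_
  refine pd_le_of_indecomposable_summands Z fun I hI hs => ?_
  obtain ⟨J, hJ, ⟨e⟩⟩ := h I hI (hs.trans hZ)
  have hlt : pd J < ⊤ := by
    rw [← pd_congr e]
    exact lt_of_le_of_lt (pd_le_of_isSummand hs) hpd
  rw [pd_congr e, ← ENat.natCast_toNat hlt.ne]
  exact_mod_cast hb ⟨J, hJ, rfl⟩

end AddClosure

/-! ### The Igusa-Todorov function in terms of syzygies. -/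

section Phi

variable {Λ : Type u} [Ring Λ] [IsArtinAlgebra Λ]

theorem IsIndecomposable.isSummand_of_syzygy_iterate_pi {I : FGModuleCat.{u} Λ}
    (hI : IsIndecomposable I) (j k : ℕ) (F : Fin k → FGModuleCat.{u} Λ)
    (h : IsSummand I (syzygy^[j] (FGModuleCat.of Λ (∀ i, F i)))) :
    ∃ i, IsSummand I (syzygy^[j] (F i)) := by
  induction k with
  | zero =>
    exfalso
    have : Subsingleton (FGModuleCat.of Λ (∀ i, F i)) :=
      inferInstanceAs (Subsingleton (∀ i : Fin 0, F i))
    obtain ⟨e⟩ := syzygy_iterate_prod j (LinearEquiv.ofSubsingleton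
      (FGModuleCat.of Λ (∀ i, F i)) (FGModuleCat.of Λ (∀ i, F i) × FGModuleCat.of Λ (∀ i, F i)))
    have h0 := cls_prod e
    rw [left_eq_add] at h0
    exact (multHom_cls_ne_zero_iff hI _).2 h (by rw [h0, map_zero])
  | succ k ih =>
    obtain ⟨e⟩ := syzygy_iterate_prod j (M := FGModuleCat.of Λ (∀ i, F i)) (X := F 0)
      (Y := FGModuleCat.of Λ (∀ i : Fin k, F i.succ))
      (Fin.consLinearEquiv Λ (fun i => F i)).symm
    rcases hI.isSummand_or_of_prod h e with h | h
    · exact ⟨0, h⟩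
    · obtain ⟨i, hi⟩ := ih _ h
      exact ⟨i.succ, hi⟩

theorem IsIndecomposable.isSummand_of_mem_addClosure {I M V : FGModuleCat.{u} Λ}
    (hI : IsIndecomposable I) (j : ℕ) (hM : M ∈ addClosure {V})
    (h : IsSummand I (syzygy^[j] M)) : IsSummand I (syzygy^[j] V) := by
  obtain ⟨k, F, hF, hs⟩ := hM
  obtain ⟨i, hi⟩ := hI.isSummand_of_syzygy_iterate_pi j k F (h.trans (hs.syzygy_iterate j))
  rwa [Set.mem_singleton_iff.1 (hF i)] at hi

namespace SyzygyClosedClass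

variable (D : SyzygyClosedClass Λ)

theorem Lbar_iterate_mk (k : ℕ) (x : K Λ) :
    D.Lbar^[k] (QuotientAddGroup.mk' (bracket D.carrier) x)
      = QuotientAddGroup.mk' (bracket D.carrier) ((L Λ)^[k] x) := by
  induction k with
  | zero => rfl
  | succ k ih =>
    rw [Function.iterate_succ_apply', Function.iterate_succ_apply', ih]
    rfl

theorem L_iterate_mem (k : ℕ) {x : K Λ} (hx : x ∈ bracket D.carrier) :
    (L Λ)^[k] x ∈ bracket D.carrier := by
  induction k with
  | zero => exact hx
  | succ k ih =>
    rw [Function.iterate_succ_apply']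
    exact D.bracket_le_comap ih

/-- Projective classes die in the quotient and `add X` has finitely many indecomposables up to
isomorphism. Containment in a finitely generated group is enough, since `ℤ` is noetherian. -/
theorem bracketBar_fg (X : FGModuleCat.{u} Λ) : (D.bracketBar X).FG := by
  obtain ⟨S, hS, h⟩ := exists_finite_indecomposable_summands X
  let π := QuotientAddGroup.mk' (bracket D.carrier)
  have hfin := hS.image fun J => π (cls J)
  have hle : D.bracketBar X ≤ AddSubgroup.closure ((fun J => π (cls J)) '' S) := by
    rw [bracketBar, AddSubgroup.map_le_iff_le_comap, bracket, AddSubgroup.closure_le]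
    rintro _ ⟨M, hM, hMi, rfl⟩
    change π (cls M) ∈ AddSubgroup.closure ((fun J => π (cls J)) '' S)
    rcases hM with hM | hM
    · obtain ⟨J, hJ, ⟨e⟩⟩ := h M hMi
        (hMi.isSummand_of_mem_addClosure 0 hM (IsSummand.refl M))
      rw [cls_congr e]
      exact AddSubgroup.subset_closure ⟨J, hJ, rfl⟩
    · have : π (cls M) = 0 :=
        (QuotientAddGroup.eq_zero_iff _).2 (AddSubgroup.subset_closure ⟨M, Or.inr hM, hMi, rfl⟩)
      rw [this]
      exact zero_mem _
  have hfg : (AddSubgroup.closure ((fun J => π (cls J)) '' S)).FG :=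
    (AddSubgroup.fg_iff _).2 ⟨_, rfl, hfin⟩
  have hfin' : Module.Finite ℤ (AddSubgroup.closure ((fun J => π (cls J)) '' S)) :=
    Module.Finite.iff_addGroup_fg.2 ((AddGroup.fg_iff_addSubgroup_fg _).2 hfg)
  rw [← AddGroup.fg_iff_addSubgroup_fg, ← Module.Finite.iff_addGroup_fg]
  exact Module.Finite.of_injective (AddSubgroup.inclusion hle).toIntLinearMap
    (AddSubgroup.inclusion_injective hle)

/-- The working form of `Φ_[𝒟]`: agreement modulo `⟨𝒟⟩` in later syzygies descends to step
`Φ_[𝒟](X)`. -/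
theorem L_iterate_phi_sub_mem {X : FGModuleCat.{u} Λ} {x y : K Λ}
    (hx : x ∈ bracket (addClosure {X})) (hy : y ∈ bracket (addClosure {X})) (n : ℕ)
    (h : (L Λ)^[D.Phi X + n] x - (L Λ)^[D.Phi X + n] y ∈ bracket D.carrier) :
    (L Λ)^[D.Phi X] x - (L Λ)^[D.Phi X] y ∈ bracket D.carrier := by
  have hmk : ∀ a b : K Λ, QuotientAddGroup.mk' (bracket D.carrier) a
      = QuotientAddGroup.mk' (bracket D.carrier) b ↔ a - b ∈ bracket D.carrier := by
    intro a b
    rw [← sub_eq_zero, ← map_sub]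
    exact QuotientAddGroup.eq_zero_iff _
  rw [← hmk, ← Lbar_iterate_mk, ← Lbar_iterate_mk] at h ⊢
  exact iterate_eta_eq_of_iterate_eq D.Lbar (D.bracketBar_fg X)
    (AddSubgroup.mem_map_of_mem _ hx) (AddSubgroup.mem_map_of_mem _ hy) n h

/-- Since `A ⊕ B` lies in `𝒟`, its classical `Φ` is `0`, so modulo projectives no power of `L`
identifies distinct elements of `⟨A ⊕ B⟩`. -/
theorem sub_mem_of_L_iterate_sub_mem (hD : PhiDim D.carrier = 0) {A B : FGModuleCat.{u} Λ}
    (hA : A ∈ D.carrier) (hB : B ∈ D.carrier) (n : ℕ)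
    (h : (L Λ)^[n] (cls A - cls B) ∈ bracket (projectives Λ)) :
    cls A - cls B ∈ bracket (projectives Λ) := by
  have hM : FGModuleCat.of Λ (A × B) ∈ D.carrier := prod_mem D.add_eq hA hB
  have hphi : (projClass Λ).Phi (FGModuleCat.of Λ (A × B)) = 0 := by
    have : ((projClass Λ).Phi (FGModuleCat.of Λ (A × B)) : ℕ∞) ≤ PhiDim D.carrier :=
      le_iSup₂ (f := fun M (_ : M ∈ D.carrier) => ((projClass Λ).Phi M : ℕ∞)) _ hM
    rw [hD] at this
    exact_mod_cast nonpos_iff_eq_zero.1 this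
  have hself := subset_addClosure {FGModuleCat.of Λ (A × B)} rfl
  have hx : cls A ∈ bracket (addClosure {FGModuleCat.of Λ (A × B)}) :=
    cls_mem_bracket_addClosure (mem_addClosure_of_isSummand
      (isSummand_left (LinearEquiv.refl Λ (A × B))) hself)
  have hy : cls B ∈ bracket (addClosure {FGModuleCat.of Λ (A × B)}) :=
    cls_mem_bracket_addClosure (mem_addClosure_of_isSummand
      (isSummand_right (LinearEquiv.refl Λ (A × B))) hself)
  have := (projClass Λ).L_iterate_phi_sub_mem hx hy n
  rw [hphi, zero_add, ← iterate_map_sub] at this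
  exact this h

end SyzygyClosedClass

end Phi

/-! ### The bound on the finitistic dimension. -/

section FiniteDimension

variable {Λ : Type u} [Ring Λ]

theorem HasShortExact.nonempty_equiv {A B C : FGModuleCat.{u} Λ} (h : HasShortExact A B C)
    [Subsingleton C] : Nonempty (A ≃ₗ[Λ] B) := by
  obtain ⟨f, g, hf, hfg, -⟩ := h
  exact ⟨LinearEquiv.ofBijective f ⟨hf, fun b => (hfg b).1 (Subsingleton.elim _ _)⟩⟩

variable [IsArtinAlgebra Λ]

theorem projective_of_indecomposable_summands (M : FGModuleCat.{u} Λ)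
    (h : ∀ I, IsIndecomposable I → IsSummand I M → I ∈ projectives Λ ∪ projectives Λ) :
    Module.Projective Λ M := by
  rw [← pd_le_zero_iff]
  exact pd_le_of_indecomposable_summands M fun I hI hs =>
    (pd_le_zero_iff I).2 ((h I hI hs).elim id id)

/-- A short exact sequence ending in a module of finite projective dimension yields an equality of
the classes of the high syzygies, up to a projective module. -/
theorem HasShortExact.L_iterate_sub_mem {A B C : FGModuleCat.{u} Λ} (h : HasShortExact A B C)
    {p : ℕ} (hp : pd C ≤ p) (X : Set (FGModuleCat.{u} Λ)) {k : ℕ} (hk : p + 1 ≤ k) :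
    (L Λ)^[k] (cls A - cls B) ∈ bracket X := by
  obtain ⟨P, hP, h'⟩ := h.syzygy_iterate k
  have : Subsingleton (LatIgusaTodorov.syzygy^[k] C) := by
    obtain ⟨d, rfl⟩ := Nat.exists_eq_add_of_le' hk
    rw [← add_assoc]
    exact subsingleton_syzygy_iterate (hp.trans (by exact_mod_cast Nat.le_add_left p d))
  obtain ⟨e⟩ := h'.nonempty_equiv
  rw [iterate_map_sub, L_iterate_cls, L_iterate_cls, cls_congr e,
    cls_prod (M := FGModuleCat.of Λ (LatIgusaTodorov.syzygy^[k] B × P)) (LinearEquiv.refl Λ _),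
    add_sub_cancel_left]
  exact cls_mem_bracket_of_projective X hP

namespace SyzygyClosedClass

variable (D : SyzygyClosedClass Λ)

/-- A high syzygy of `I` vanishes, as for the zero module, so `Φdim 𝒟 = 0` puts `[I]` in `⟨𝒫⟩`; the
multiplicity of `I` in itself then forces it to be projective. -/
theorem mem_projectives_of_pd_le (hD : PhiDim D.carrier = 0) {I : FGModuleCat.{u} Λ}
    (hI : IsIndecomposable I) (hID : I ∈ D.carrier) {p : ℕ} (hp : pd I ≤ p) :
    I ∈ projectives Λ := by
  have h0 : FGModuleCat.of Λ PUnit.{u + 1} ∈ D.carrier := mem_of_subsingleton D.add_eq _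
  have hz : cls (FGModuleCat.of Λ PUnit.{u + 1}) = 0 := cls_eq_zero _
  have := subsingleton_syzygy_iterate hp
  have h := D.sub_mem_of_L_iterate_sub_mem hD hID h0 (p + 1) (by
    rw [hz, sub_zero, L_iterate_cls, cls_eq_zero]
    exact zero_mem _)
  rw [hz, sub_zero] at h
  by_contra hcon
  exact (multHom_cls_ne_zero_iff hI I).2 (IsSummand.refl I)
    (multHom_eq_zero_of_mem_bracket hI (addClosure_projectives Λ) (by simpa using hcon) h)

/-- If `E₁` and `E₀` are built from `𝒟` and `𝒫` and have the same high syzygies up to projectives,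
then they agree up to projectives. -/
theorem sub_mem_bracket_projectives (hD : PhiDim D.carrier = 0) {E₁ E₀ : FGModuleCat.{u} Λ}
    (h₁ : ∀ I, IsIndecomposable I → IsSummand I E₁ → I ∈ D.carrier ∪ projectives Λ)
    (h₀ : ∀ I, IsIndecomposable I → IsSummand I E₀ → I ∈ D.carrier ∪ projectives Λ)
    (n : ℕ) (h : (L Λ)^[n] (cls E₁ - cls E₀) ∈ bracket (projectives Λ)) :
    cls E₁ - cls E₀ ∈ bracket (projectives Λ) := by
  obtain ⟨A, hA, P, hP, ⟨e⟩⟩ := exists_equiv_prod_of_summands_mem D.add_eq E₁ h₁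
  obtain ⟨B, hB, Q, hQ, ⟨f⟩⟩ := exists_equiv_prod_of_summands_mem D.add_eq E₀ h₀
  have hPQ : cls P - cls Q ∈ bracket (projectives Λ) :=
    sub_mem (cls_mem_bracket_of_projective _ hP) (cls_mem_bracket_of_projective _ hQ)
  have hE : cls E₁ - cls E₀ = (cls A - cls B) + (cls P - cls Q) := by
    rw [cls_prod e, cls_prod f]
    abel
  rw [hE] at h ⊢
  refine add_mem (D.sub_mem_of_L_iterate_sub_mem hD hA hB n ?_) hPQ
  rw [iterate_map_add] at h
  exact (AddSubgroup.add_mem_cancel_right _ ((projClass Λ).L_iterate_mem n hPQ)).1 h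

/-- The bound on the projective dimension of a module resolved by `add V` and `𝒟`. -/
theorem pd_le_Psi_add_one (hD : PhiDim D.carrier = 0) {V V₁ V₀ D₁ D₀ N : FGModuleCat.{u} Λ}
    (hV₁ : V₁ ∈ addClosure {V}) (hV₀ : V₀ ∈ addClosure {V}) (hD₁ : D₁ ∈ D.carrier)
    (hD₀ : D₀ ∈ D.carrier)
    (h : HasShortExact (FGModuleCat.of Λ (V₁ × D₁)) (FGModuleCat.of Λ (V₀ × D₀)) N)
    (hN : pd N < ⊤) : pd N ≤ D.Psi V + 1 := by
  obtain ⟨p, hp⟩ := exists_pd_le hN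
  rw [Psi]
  obtain ⟨d, hd⟩ := ENat.ne_top_iff_exists.1
    (finDimClass_summands_lt_top (syzygy^[D.Phi V] V)).ne
  rw [← hd]
  set φ := D.Phi V
  have cls_of : ∀ X Y : FGModuleCat.{u} Λ, cls (FGModuleCat.of Λ (X × Y)) = cls X + cls Y :=
    fun X Y => cls_prod (LinearEquiv.refl Λ (X × Y))
  -- the components in `add V` agree modulo `⟨𝒟⟩` after `φ` steps
  have hbr : cls (syzygy^[φ] V₁) - cls (syzygy^[φ] V₀) ∈ bracket D.carrier := by
    rw [← L_iterate_cls, ← L_iterate_cls]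
    refine D.L_iterate_phi_sub_mem (cls_mem_bracket_addClosure hV₁)
      (cls_mem_bracket_addClosure hV₀) (p + 1) ?_
    have h1 := h.L_iterate_sub_mem hp D.carrier (k := φ + (p + 1)) (by omega)
    have hDD : cls D₁ - cls D₀ ∈ bracket D.carrier :=
      sub_mem (cls_mem_bracket D.add_eq hD₁) (cls_mem_bracket D.add_eq hD₀)
    rw [cls_of, cls_of, add_sub_add_comm, iterate_map_add] at h1
    rw [← iterate_map_sub]
    exact (AddSubgroup.add_mem_cancel_right _ (D.L_iterate_mem _ hDD)).1 h1
  obtain ⟨W, A, B, ⟨eA⟩, ⟨eB⟩, hA, hB⟩ := exists_equiv_prod_of_sub_mem_bracket D.add_eq hbr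
  obtain ⟨Q, hQ, hs⟩ := h.syzygy_iterate φ
  obtain ⟨f₁⟩ := syzygy_iterate_prod φ (M := FGModuleCat.of Λ (V₁ × D₁))
    (LinearEquiv.refl Λ (V₁ × D₁))
  obtain ⟨f₀⟩ := syzygy_iterate_prod φ (M := FGModuleCat.of Λ (V₀ × D₀))
    (LinearEquiv.refl Λ (V₀ × D₀))
  have hΩD : ∀ X ∈ D.carrier, ∀ j, syzygy^[j] X ∈ D.carrier := by
    intro X hX j
    induction j with
    | zero => exact hX
    | succ j ih =>
      rw [Function.iterate_succ_apply']
      exact D.syzygy_mem _ ih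
  have mem_of : ∀ I X : FGModuleCat.{u} Λ, X ∈ D.carrier → IsSummand I X →
      I ∈ D.carrier ∪ projectives Λ := fun I X hX h => Or.inl (mem_of_isSummand D.add_eq hX h)
  let E₁ : FGModuleCat.{u} Λ := FGModuleCat.of Λ (A × syzygy^[φ] D₁)
  -- The projective horseshoe excess `Q` is absorbed in the right-hand leftover, so that both terms
  -- have the form `W` plus a module built from `𝒟` and `𝒫`.
  let DQ : FGModuleCat.{u} Λ := FGModuleCat.of Λ (syzygy^[φ] D₀ × Q)
  let E₀ : FGModuleCat.{u} Λ := FGModuleCat.of Λ (B × DQ)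
  have hE₁ : ∀ I, IsIndecomposable I → IsSummand I E₁ → I ∈ D.carrier ∪ projectives Λ := by
    intro I hI hIs
    rcases hI.isSummand_or_of_prod hIs (LinearEquiv.refl Λ (A × syzygy^[φ] D₁)) with h | h
    · exact hA I hI h
    · exact mem_of I _ (hΩD _ hD₁ φ) h
  have hE₀ : ∀ I, IsIndecomposable I → IsSummand I E₀ → I ∈ D.carrier ∪ projectives Λ := by
    intro I hI hIs
    rcases hI.isSummand_or_of_prod hIs (LinearEquiv.refl Λ (B × DQ)) with h | h
    · exact hB I hI h
    rcases hI.isSummand_or_of_prod h (LinearEquiv.refl Λ (syzygy^[φ] D₀ × Q)) with h | h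
    · exact mem_of I _ (hΩD _ hD₀ φ) h
    · exact Or.inr (mem_of_isSummand (addClosure_projectives Λ) hQ h)
  have hsE : HasShortExact (FGModuleCat.of Λ (W × E₁)) (FGModuleCat.of Λ (W × E₀))
      (syzygy^[φ] N) := by
    refine hs.of_equiv (A' := FGModuleCat.of Λ (W × E₁)) (B' := FGModuleCat.of Λ (W × E₀))
      (f₁ ≪≫ₗ eA.prodCongr (LinearEquiv.refl Λ (syzygy^[φ] D₁)) ≪≫ₗ
        LinearEquiv.prodAssoc Λ W A (syzygy^[φ] D₁)) ?_ (LinearEquiv.refl Λ _)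
    exact f₀.prodCongr (LinearEquiv.refl Λ Q) ≪≫ₗ
      LinearEquiv.prodAssoc Λ (syzygy^[φ] V₀) (syzygy^[φ] D₀) Q ≪≫ₗ
      eB.prodCongr (LinearEquiv.refl Λ DQ) ≪≫ₗ LinearEquiv.prodAssoc Λ W B DQ
  have hpφ : pd (syzygy^[φ] N) ≤ p :=
    (pd_syzygy_iterate_le_iff φ N p).2 (hp.trans (by exact_mod_cast Nat.le_add_right p φ))
  -- the remaining components agree modulo projectives
  have hbrE : cls E₁ - cls E₀ ∈ bracket (projectives Λ) := by
    have h1 := hsE.L_iterate_sub_mem hpφ (projectives Λ) le_rfl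
    rw [cls_of W E₁, cls_of W E₀, add_sub_add_left_eq_sub] at h1
    exact D.sub_mem_bracket_projectives hD hE₁ hE₀ _ h1
  obtain ⟨T, P₁, P₀, ⟨g₁⟩, ⟨g₀⟩, hP₁, hP₀⟩ :=
    exists_equiv_prod_of_sub_mem_bracket (addClosure_projectives Λ) hbrE
  replace hP₁ := projective_of_indecomposable_summands P₁ hP₁
  replace hP₀ := projective_of_indecomposable_summands P₀ hP₀
  let Z : FGModuleCat.{u} Λ := FGModuleCat.of Λ (W × T)
  have hsZ : HasShortExact (FGModuleCat.of Λ (Z × P₁)) (FGModuleCat.of Λ (Z × P₀))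
      (syzygy^[φ] N) := by
    refine hsE.of_equiv (A' := FGModuleCat.of Λ (Z × P₁)) (B' := FGModuleCat.of Λ (Z × P₀))
      ?_ ?_ (LinearEquiv.refl Λ _)
    · exact (LinearEquiv.refl Λ W).prodCongr g₁ ≪≫ₗ (LinearEquiv.prodAssoc Λ W T P₁).symm
    · exact (LinearEquiv.refl Λ W).prodCongr g₀ ≪≫ₗ (LinearEquiv.prodAssoc Λ W T P₀).symm
  obtain ⟨f, g, hf, hfg, hg⟩ := hsZ
  obtain ⟨Z₁, hZ₁, f', g', hf', hfg', hg', hnil⟩ := exists_summand_isNilpotent hf hfg hg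
  -- This bound depends on `N` and serves only to make `pd Z₁` finite; finiteness is what lets the
  -- uniform bound `d` apply next.
  have hpZ : pd Z₁ ≤ p := pd_le_of_isNilpotent hP₁ hP₀ hf' hfg' hg' hnil hpφ
  have hdZ : pd Z₁ ≤ d := by
    refine pd_le_of_indecomposable_summands Z₁ fun I hI hIs => ?_
    have hpI : pd I ≤ p := (pd_le_of_isSummand hIs).trans hpZ
    rcases hI.isSummand_or_of_prod (hIs.trans hZ₁) (LinearEquiv.refl Λ (W × T)) with h | h
    · have hIV : IsSummand I (syzygy^[φ] V) :=
        hI.isSummand_of_mem_addClosure φ hV₁ (h.trans (isSummand_left eA))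
      rw [hd]
      exact le_iSup₂_of_le (f := fun M (_ : M ∈ {Z | IsSummand Z (syzygy^[φ] V)}) =>
        ⨆ (_ : pd M < ⊤), pd M) I hIV (le_iSup_of_le (pd_lt_top_of_le hpI) le_rfl)
    -- Here `I` is a summand of `T`, hence of `E₁`, so it lies in `𝒟` or `𝒫`; finite projective
    -- dimension makes it projective in either case.
    · refine pd_le_of_projective ?_ d
      exact (hE₁ I hI (h.trans (isSummand_left g₁))).elim
        (fun hID => D.mem_projectives_of_pd_le hD hI hID hpI) id
  have hsf : HasShortExact (FGModuleCat.of Λ (Z₁ × P₁)) (FGModuleCat.of Λ (Z₁ × P₀))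
      (syzygy^[φ] N) := ⟨f', g', hf', hfg', hg'⟩
  have hfin : pd (syzygy^[φ] N) ≤ (d + 1 : ℕ) := by
    refine hsf.pd_right (pd_prod_le (LinearEquiv.refl Λ (Z₁ × P₁)) hdZ (pd_le_of_projective hP₁ d))
      (pd_prod_le (LinearEquiv.refl Λ (Z₁ × P₀)) (hdZ.trans ?_) (pd_le_of_projective hP₀ _))
    exact_mod_cast Nat.le_succ d
  rw [pd_syzygy_iterate_le_iff] at hfin
  refine hfin.trans (le_of_eq ?_)
  push_cast
  ring

end SyzygyClosedClass

theorem SyzygyClosedClass.Psi_lt_top (D : SyzygyClosedClass Λ) (V : FGModuleCat.{u} Λ) :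
    D.Psi V < ⊤ :=
  WithTop.add_lt_top.2 ⟨ENat.natCast_lt_top _, finDimClass_summands_lt_top _⟩

/-- The resolution exists for `Ω^n M`, whose projective dimension is again finite; dimension shift
accounts for the summand `n`. -/
theorem IsLITWith.finDim_le {n : ℕ} {V : FGModuleCat.{u} Λ} {D : SyzygyClosedClass Λ}
    (h : IsLITWith n V D) : finDim Λ ≤ D.Psi V + n + 1 := by
  refine iSup₂_le fun M _ => iSup_le fun hM => ?_
  obtain ⟨q, hq⟩ := exists_pd_le hM
  obtain ⟨V₁, hV₁, V₀, hV₀, D₁, hD₁, D₀, hD₀, hs⟩ := h.exact_seq M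
  have hN : pd (syzygy^[n] M) ≤ q :=
    (pd_syzygy_iterate_le_iff n M q).2 (hq.trans (by exact_mod_cast Nat.le_add_right q n))
  have hle := D.pd_le_Psi_add_one h.phiDim_eq_zero hV₁ hV₀ hD₁ hD₀ hs (pd_lt_top_of_le hN)
  obtain ⟨c, hc⟩ := ENat.ne_top_iff_exists.1 (D.Psi_lt_top V).ne
  rw [← hc] at hle ⊢
  have h1 : pd (syzygy^[n] M) ≤ (c + 1 : ℕ) := by exact_mod_cast hle
  rw [pd_syzygy_iterate_le_iff] at h1
  refine h1.trans (le_of_eq ?_)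
  push_cast
  ring

end FiniteDimension

/-! ### Igusa-Todorov algebras and self-injective algebras. -/

section InjectiveAlgebra

variable {Λ : Type u} [Ring Λ]

/-- Take `𝒟 = 𝒫` with zero `𝒟`-parts. For projective `M` the image of `⟨M⟩` modulo `⟨𝒫⟩` is zero, so
`Φ(M) = 0`. -/
theorem IsIT.isLIT [IsArtinAlgebra Λ] {n : ℕ} (h : IsIT Λ n) : IsLIT Λ n := by
  obtain ⟨V, hV⟩ := h
  refine ⟨V, projClass Λ, ?_, fun M => ?_⟩
  · refine le_antisymm (iSup₂_le fun M hM => ?_) bot_le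
    have hbot : (projClass Λ).bracketBar M = ⊥ := by
      rw [SyzygyClosedClass.bracketBar, eq_bot_iff, AddSubgroup.map_le_iff_le_comap, bracket,
        AddSubgroup.closure_le]
      rintro _ ⟨N, hN, -, rfl⟩
      refine (QuotientAddGroup.eq_zero_iff _).2 (cls_mem_bracket_of_projective _ ?_)
      refine hN.elim (fun hN => ?_) id
      change N ∈ projectives Λ
      rw [← addClosure_projectives]
      obtain ⟨k, F, hF, hs⟩ := hN
      exact ⟨k, F, fun i => by rw [Set.mem_singleton_iff.1 (hF i)]; exact hM, hs⟩
    have hzero : (projClass Λ).Phi M = 0 := by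
      rw [SyzygyClosedClass.Phi, hbot]
      refine Nat.sInf_eq_zero.2 (Or.inl fun m _ => ?_)
      simp [iterate_map_zero]
    rw [hzero]
    exact le_rfl
  · obtain ⟨V₁, hV₁, V₀, hV₀, f, g, hf, hfg, hg⟩ := hV M
    let O : FGModuleCat.{u} Λ := FGModuleCat.of Λ PUnit.{u + 1}
    have hO : O ∈ (projClass Λ).carrier := mem_of_subsingleton (projClass Λ).add_eq O
    have hs : HasShortExact V₁ V₀ (syzygy^[n] M) := ⟨f, g, hf, hfg, hg⟩
    exact ⟨V₁, hV₁, V₀, hV₀, O, hO, O, hO,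
      hs.of_equiv (A' := FGModuleCat.of Λ (V₁ × O)) (B' := FGModuleCat.of Λ (V₀ × O))
        (LinearEquiv.prodUnique (R := Λ) (M := V₁) (M₂ := PUnit.{u + 1})).symm
        (LinearEquiv.prodUnique (R := Λ) (M := V₀) (M₂ := PUnit.{u + 1})).symm
        (LinearEquiv.refl Λ _)⟩

/-- A finitely generated projective is a retract of some `Λ^n`, which is injective. -/
theorem injective_of_projective_of_finite [Module.Injective Λ Λ] (P : FGModuleCat.{u} Λ)
    (hP : Module.Projective Λ P) : Module.Injective Λ P := by
  obtain ⟨n, f, hf⟩ := Module.Finite.exists_fin' Λ P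
  obtain ⟨s, hs⟩ := Module.projective_lifting_property f LinearMap.id hf
  refine ⟨fun X Y _ _ _ _ i hi g => ?_⟩
  obtain ⟨h, hh⟩ := Module.Injective.extension_property Λ (Fin n → Λ) X Y i hi (s ∘ₗ g)
  refine ⟨f ∘ₗ h, fun x => ?_⟩
  have h1 : h (i x) = s (g x) := LinearMap.congr_fun hh x
  have h2 : f (s (g x)) = g x := LinearMap.congr_fun hs (g x)
  rw [LinearMap.comp_apply, h1, h2]

theorem HasShortExact.cls_eq_of_injective {A B C : FGModuleCat.{u} Λ} (h : HasShortExact A B C)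
    (hA : Module.Injective Λ A) : cls B = cls A + cls C := by
  obtain ⟨f, g, hf, hfg, hg⟩ := h
  obtain ⟨r, hr⟩ := hA.out f hf LinearMap.id
  have hr' : ∀ a, r (f a) = a := hr
  refine cls_prod (LinearEquiv.ofBijective (r.prod g) ⟨?_, ?_⟩)
  · rw [← LinearMap.ker_eq_bot, LinearMap.ker_eq_bot']
    intro b hb
    obtain ⟨a, rfl⟩ := (hfg b).1 (congrArg Prod.snd hb)
    have h1 : r (f a) = 0 := congrArg Prod.fst hb
    rw [hr'] at h1
    rw [h1, map_zero]
  · rintro ⟨a, c⟩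
    obtain ⟨b, rfl⟩ := hg c
    refine ⟨f (a - r b) + b, Prod.ext ?_ ?_⟩
    · change r (f (a - r b) + b) = a
      rw [map_add, hr', sub_add_cancel]
    · change g (f (a - r b) + b) = g b
      rw [map_add, hfg.apply_apply_eq_zero, zero_add]

/-- The short exact sequence `0 → J → (I ⊕ J) / Y → A → 0` given by the pushout of a short exact
sequence `0 → Y → I → A → 0` along a map `Y → J`. -/
theorem hasShortExact_pushout {Y I J A : FGModuleCat.{u} Λ} {f : Y →ₗ[Λ] I} {g : I →ₗ[Λ] A}
    (hf : Function.Injective f) (hfg : Function.Exact f g) (hg : Function.Surjective g)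
    (f' : Y →ₗ[Λ] J) :
    HasShortExact J (FGModuleCat.of Λ ((I × J) ⧸ LinearMap.range (f.prod f'))) A := by
  have hle : LinearMap.range (f.prod f') ≤ LinearMap.ker (g ∘ₗ LinearMap.fst Λ I J) := by
    rintro _ ⟨y, rfl⟩
    exact hfg.apply_apply_eq_zero y
  refine ⟨(LinearMap.range (f.prod f')).mkQ ∘ₗ LinearMap.inr Λ I J,
    (LinearMap.range (f.prod f')).liftQ (g ∘ₗ LinearMap.fst Λ I J) hle, ?_, ?_, ?_⟩
  · rw [← LinearMap.ker_eq_bot, LinearMap.ker_eq_bot']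
    intro j hj
    obtain ⟨y, hy⟩ := (Submodule.Quotient.mk_eq_zero _).1 hj
    have h1 : f y = 0 := congrArg Prod.fst hy
    have h2 : f' y = j := congrArg Prod.snd hy
    rw [← h2, (map_eq_zero_iff f hf).1 h1, map_zero]
  · intro x
    obtain ⟨⟨i, j⟩, rfl⟩ := Submodule.mkQ_surjective _ x
    constructor
    · intro hx
      obtain ⟨y, rfl⟩ := (hfg i).1 hx
      refine ⟨j - f' y, (Submodule.Quotient.eq _).2 ⟨-y, ?_⟩⟩
      refine Prod.ext ?_ ?_
      · change f (-y) = 0 - f y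
        rw [map_neg, zero_sub]
      · change f' (-y) = j - f' y - j
        rw [map_neg]
        abel
    · rintro ⟨j', hj'⟩
      rw [← hj']
      change g 0 = 0
      exact map_zero g
  · intro a
    obtain ⟨i, rfl⟩ := hg a
    exact ⟨(LinearMap.range (f.prod f')).mkQ (i, 0), rfl⟩

/-- The dual of Schanuel's lemma. -/
theorem HasShortExact.cls_add_cls_eq {Y I J A B : FGModuleCat.{u} Λ} (h : HasShortExact Y I A)
    (h' : HasShortExact Y J B) (hI : Module.Injective Λ I) (hJ : Module.Injective Λ J) :
    cls J + cls A = cls I + cls B := by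
  obtain ⟨f, g, hf, hfg, hg⟩ := h
  obtain ⟨f', g', hf', hfg', hg'⟩ := h'
  -- The pushout `(I ⊕ J) / Y` is an extension of `A` by `J` and of `B` by `I`; both split by
  -- injectivity.
  have h1 := (hasShortExact_pushout hf hfg hg f').cls_eq_of_injective hJ
  have h2 := (hasShortExact_pushout hf' hfg' hg' f).cls_eq_of_injective hI
  rw [← h1, ← h2]
  refine cls_congr (Submodule.Quotient.equiv _ _ (LinearEquiv.prodComm Λ I J) ?_)
  rw [← LinearMap.range_comp]
  rfl

theorem HasShortExact.prod_right {A B C : FGModuleCat.{u} Λ} (h : HasShortExact A B C)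
    (X : FGModuleCat.{u} Λ) :
    HasShortExact (FGModuleCat.of Λ (A × X)) (FGModuleCat.of Λ (B × X)) C := by
  obtain ⟨f, g, hf, hfg, hg⟩ := h
  refine ⟨f.prodMap LinearMap.id, g ∘ₗ LinearMap.fst Λ B X, ?_, ?_, ?_⟩
  · exact Function.Injective.prodMap hf Function.injective_id
  · rintro ⟨b, x⟩
    constructor
    · intro hb
      obtain ⟨a, rfl⟩ := (hfg b).1 hb
      exact ⟨(a, x), rfl⟩
    · rintro ⟨⟨a, x'⟩, hax⟩
      have h1 : f a = b := congrArg Prod.fst hax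
      change g b = 0
      rw [← h1]
      exact hfg.apply_apply_eq_zero a
  · exact hg.comp (LinearMap.fst_surjective (R := Λ) (M := B) (M₂ := X))

variable [IsArtinAlgebra Λ]

/-- If `Ω A` and `Ω B` agree up to projectives, adding projectives gives `A` and `B` a common kernel
inside projective modules. These are injective, so the dual Schanuel lemma identifies `A` and `B` up
to projectives. -/
theorem Lbar_injective_of_injective [Module.Injective Λ Λ] :
    Function.Injective (projClass Λ).Lbar := by
  rw [injective_iff_map_eq_zero]
  intro z hz
  obtain ⟨x, rfl⟩ := QuotientAddGroup.mk_surjective z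
  obtain ⟨A, B, rfl⟩ := exists_eq_cls_sub_cls x
  have hL : cls (syzygy A) - cls (syzygy B) ∈ bracket (projectives Λ) := by
    rw [← L_cls, ← L_cls, ← map_sub]
    exact (QuotientAddGroup.eq_zero_iff _).1 hz
  refine (QuotientAddGroup.eq_zero_iff _).2 ?_
  obtain ⟨W, P, Q, ⟨e⟩, ⟨e'⟩, hP, hQ⟩ :=
    exists_equiv_prod_of_sub_mem_bracket (addClosure_projectives Λ) hL
  replace hP := projective_of_indecomposable_summands P hP
  replace hQ := projective_of_indecomposable_summands Q hQ
  obtain ⟨I, hI, hsI⟩ := exists_shortExact_syzygy A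
  obtain ⟨J, hJ, hsJ⟩ := exists_shortExact_syzygy B
  let IQ : FGModuleCat.{u} Λ := FGModuleCat.of Λ (I × Q)
  let JP : FGModuleCat.{u} Λ := FGModuleCat.of Λ (J × P)
  have hIQ : Module.Projective Λ IQ := inferInstanceAs (Module.Projective Λ (I × Q))
  have hJP : Module.Projective Λ JP := inferInstanceAs (Module.Projective Λ (J × P))
  -- Crosswise padding: `Ω A ⊕ Q` and `Ω B ⊕ P` are both `W ⊕ P ⊕ Q` up to order.
  have h1 : HasShortExact (FGModuleCat.of Λ (syzygy B × P)) IQ A := by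
    refine (hsI.prod_right Q).of_equiv (A' := FGModuleCat.of Λ (syzygy B × P)) ?_
      (LinearEquiv.refl Λ IQ) (LinearEquiv.refl Λ A)
    exact e.prodCongr (LinearEquiv.refl Λ Q) ≪≫ₗ LinearEquiv.prodAssoc Λ W P Q ≪≫ₗ
      (LinearEquiv.refl Λ W).prodCongr (LinearEquiv.prodComm Λ P Q) ≪≫ₗ
      (LinearEquiv.prodAssoc Λ W Q P).symm ≪≫ₗ e'.symm.prodCongr (LinearEquiv.refl Λ P)
  have h2 : HasShortExact (FGModuleCat.of Λ (syzygy B × P)) JP B := hsJ.prod_right P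
  have h3 := h1.cls_add_cls_eq h2 (injective_of_projective_of_finite IQ hIQ)
    (injective_of_projective_of_finite JP hJP)
  have h4 : cls A - cls B = cls IQ - cls JP := by
    rw [sub_eq_sub_iff_add_eq_add, add_comm, h3]
  rw [h4]
  exact sub_mem (cls_mem_bracket_of_projective _ hIQ) (cls_mem_bracket_of_projective _ hJP)

/-- With `𝒟` all modules and `V = 0`, the sequence `0 → 0 → M → M → 0` serves every `M`, and
injectivity of `L` modulo projectives makes `Φ` vanish identically. -/
theorem isLIT_zero_of_injective [Module.Injective Λ Λ] : IsLIT Λ 0 := by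
  let D : SyzygyClosedClass Λ :=
    { carrier := Set.univ
      add_eq := Set.Subset.antisymm (Set.subset_univ _) (subset_addClosure _)
      syzygy_mem := fun _ _ => Set.mem_univ _ }
  let O : FGModuleCat.{u} Λ := FGModuleCat.of Λ PUnit.{u + 1}
  have hO : O ∈ addClosure {O} := subset_addClosure _ rfl
  refine ⟨O, D, ?_, fun M => ?_⟩
  · refine le_antisymm (iSup₂_le fun M hM => ?_) bot_le
    rw [SyzygyClosedClass.Phi, eta_eq_zero_of_injective Lbar_injective_of_injective]
    exact le_rfl
  · have hs : HasShortExact O M M := ⟨0, LinearMap.id, fun _ _ _ => rfl,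
      fun m => ⟨fun h => ⟨0, h.symm⟩, fun ⟨_, h⟩ => h.symm⟩, Function.surjective_id⟩
    exact ⟨O, hO, O, hO, O, Set.mem_univ _, M, Set.mem_univ _,
      hs.of_equiv (A' := FGModuleCat.of Λ (O × O)) (B' := FGModuleCat.of Λ (O × M))
        (LinearEquiv.prodUnique (R := Λ) (M := PUnit.{u + 1}) (M₂ := PUnit.{u + 1})).symm
        (LinearEquiv.uniqueProd (R := Λ) (M := M) (M₂ := PUnit.{u + 1})).symm
        (LinearEquiv.refl Λ M)⟩

end InjectiveAlgebra

end LatIgusaTodorov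

theorem theorem5 (Λ : Type u) [Ring Λ] [LatIgusaTodorov.IsArtinAlgebra Λ] :
    (∀ (n : ℕ) (V : FGModuleCat.{u} Λ) (D : LatIgusaTodorov.SyzygyClosedClass Λ),
      LatIgusaTodorov.IsLITWith n V D →
        LatIgusaTodorov.finDim Λ ≤ D.Psi V + n + 1 ∧ D.Psi V + n + 1 < ⊤) ∧
    (∀ n : ℕ, LatIgusaTodorov.IsLIT Λ n → LatIgusaTodorov.finDim Λ < ⊤) ∧
    (∀ n : ℕ, LatIgusaTodorov.IsIT Λ n → LatIgusaTodorov.IsLIT Λ n) ∧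
    (Module.Injective Λ Λ → LatIgusaTodorov.IsLIT Λ 0) := by
  have h1 : ∀ (n : ℕ) (V : FGModuleCat.{u} Λ) (D : LatIgusaTodorov.SyzygyClosedClass Λ),
      LatIgusaTodorov.IsLITWith n V D →
        LatIgusaTodorov.finDim Λ ≤ D.Psi V + n + 1 ∧ D.Psi V + n + 1 < ⊤ := by
    intro n V D h
    refine ⟨h.finDim_le, ?_⟩
    obtain ⟨c, hc⟩ := ENat.ne_top_iff_exists.1 (D.Psi_lt_top V).ne
    rw [← hc]
    exact_mod_cast ENat.natCast_lt_top (c + n + 1)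
  refine ⟨h1, ?_, fun n h => h.isLIT, fun _ => LatIgusaTodorov.isLIT_zero_of_injective⟩
  rintro n ⟨V, D, h⟩
  exact lt_of_le_of_lt (h1 n V D h).1 (h1 n V D h).2
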